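/- Write $\mathbb N=\{0,1,2,\dots\}$, let $\delta_0$ be the Dirac mass at $0$, let $*$ denote convolution on $\mathbb Z$ and $\|\cdot\|_{\ell^1}$ the $\ell^1(\mathbb Z)$ norm, and put $a^{*0}=\delta_0$. Let $\mu$ be a CCM probability measure on $\mathbb Z$ with representative measure $\nu$; that is, $\mu$ is supported on $\{-1\}\cup\mathbb N$ and $\nu$ is a finite positive measure on $[0,1]$ such that $$\int_0^1\frac{\nu(dt)}{(1-t)^2}=1,\qquad \mu(n)=\int_0^1t^n\,\nu(dt)\quad(n\in\mathbb N),\qquad \mu(-1)=1-\int_0^1\frac{\nu(dt)}{1-t}.$$ Assume that there exists $L>0$ such that $$n\sum_{k\ge n}k\,\mu(k)\le L\sum_{k=1}^nk^2\mu(k)\qquad\text{for all } n\in\mathbb N.$$ Then $\mu$ is Ritt, i.e. $\sup_{n\ge1}n\,\|\mu^{*n}-\mu^{*(n+1)}\|_{\ell^1}<\infty$, and for every $m\in\mathbb N$ there exists $C_m>0$ such that for every $f\in\ell^1(\mathbb Z)$, $$\sup_{\lambda>0}\lambda\,\#\Big\{k\in\mathbb Z:\ \sup_{n\ge1}n^m\big|\big(\mu^{*n}*(\delta_0-\mu)^{*m}*f\big)(k)\big|\ge\lambda\Big\}\le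 C_m\|f\|_{\ell^1}.$$ -/

import Mathlib

open MeasureTheory Set
open scoped ENNReal NNReal

namespace RittZ

/-- The weights `k ↦ μ(k)` of a measure on `ℤ`. -/
noncomputable def mass (μ : Measure ℤ) : ℤ → ℝ := fun k => μ.real {k}

/-- The sequence of the Dirac mass at `0`. -/
def delta : ℤ → ℝ := Pi.single 0 1

/-- Convolution on `ℤ` of a real kernel `a` with a real- or vector-valued sequence `f`:
`(a * f)(k) = ∑_{j ∈ ℤ} a(k - j) f(j)`. It is only used for absolutely summable sequences. -/
noncomputable def conv {E : Type*} [NormedAddCommGroup E] [NormedSpace ℝ E]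
    (a : ℤ → ℝ) (f : ℤ → E) : ℤ → E :=
  fun k => ∑' j : ℤ, a (k - j) • f j

/-- The convolution powers `a^{*n}`, with `a^{*0} = δ₀`. -/
noncomputable def convPow (a : ℤ → ℝ) : ℕ → ℤ → ℝ
  | 0 => delta
  | n + 1 => conv (convPow a n) a

/-- The `ℓ¹(ℤ)` norm, with value `∞` for a sequence that is not absolutely summable. -/
noncomputable def l1Norm {E : Type*} [NormedAddCommGroup E] (f : ℤ → E) : ℝ≥0∞ :=
  ∑' k : ℤ, ‖f k‖ₑ

/-- `μ` is Ritt: `sup_{n ≥ 1} n ‖μ^{*n} - μ^{*(n+1)}‖_{ℓ¹(ℤ)} < ∞`. -/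
def IsRitt (μ : Measure ℤ) : Prop :=
  (⨆ n : ℕ, ⨆ _ : 1 ≤ n,
    (n : ℝ≥0∞) * l1Norm (convPow (mass μ) n - convPow (mass μ) (n + 1))) < ∞

/-- `μ` is CCM with representative measure `ν`. The normalization is an integral with values
in `[0, ∞]`, where `1 / 0 = ∞`; hence it forces `ν {1} = 0`. -/
structure IsCCM (μ : Measure ℤ) (ν : Measure ℝ) : Prop where
  support : μ {k : ℤ | k < -1} = 0
  finite : IsFiniteMeasure ν
  unit_interval : ν (Icc 0 1)ᶜ = 0
  normalized : ∫⁻ t, 1 / ENNReal.ofReal (1 - t) ^ 2 ∂ν = 1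
  nat_mass : ∀ n : ℕ, mass μ n = ∫ t, t ^ n ∂ν
  neg_one_mass : mass μ (-1) = 1 - ∫ t, 1 / (1 - t) ∂ν

/-- The maximal function `k ↦ sup_{n ≥ 1} n^m |(μ^{*n} * (δ₀ - μ)^{*m} * f)(k)|`. -/
noncomputable def maximalFn (μ : Measure ℤ) (m : ℕ) (f : ℤ → ℂ) (k : ℤ) : ℝ≥0∞ :=
  ⨆ n : ℕ, ⨆ _ : 1 ≤ n, (n : ℝ≥0∞) ^ m *
    ‖conv (conv (convPow (mass μ) n) (convPow (delta - mass μ) m)) f k‖ₑ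

end RittZ

/-! Write σ for `tilt ν`, S(u) = ∫ u/((1-t)+u) dσ(t) and Q(u) = u S'(u). The Fourier transform of μ
is 1 - ψ with ψ(θ) = |1 - e^{iθ}|² ∫ dσ(t)/(1 - t e^{iθ}) (`IsCCM.ft_mass`). If v is the distance of
θ to {0, 2π}, then |ψ|, |ψ'|, |ψ''| are at most a constant times v S(v), S(v), S(v)/v, while Re ψ is
at least v Q(v)/4.

The tail condition is equivalent in effect to a bound S ≤ A Q on (0, 4]
(`IsCCM.profile_le_profileDeriv`): the tail dominates ∫ t^{n-1} dσ, the truncated second moment is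
O(n Q(1/n)), and S(1/n) ≤ 2 ∫ t^{n-1} dσ + 3 Q(1/n). Together with μ(0) > 0 this yields |1 - ψ| ≤
exp(-c v S(v)).

Hence the symbol (nψ)^m (1-ψ)^n of n^m μ^{*n} * (δ₀ - μ)^{*m} is controlled by powers of 1 + X times
e^{-cX}, where X = n v S(v). Choose N so that X is of order one at v = 1/N, or N = 1. The symbol has
integral O(1/N). Its second derivative has integral O(N): away from the singularity it is O(1/v²),
and near it O(n S(v)/v) ≤ O(n S'(v)), whose integral is O(n S(1/N)) = O(N). Two integrations by
parts bound the kernel by min(1/N, N/x²) up to a constant (`exists_kernel_bound`). Such kernels are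
uniformly bounded in ℓ¹, which for m = 1 is the Ritt property, and they are dominated by the
Hardy-Littlewood maximal function, which is of weak type (1,1). -/

namespace RittZ

/-! ### Hardy-Littlewood maximal function on ℤ and the kernels it dominates. -/

section MaximalFunction

/-- The weak type `(1,1)` bound of the Hardy-Littlewood maximal function on `ℤ`, on finite sets. -/
theorem card_mul_le_of_average_ge (F : ℤ → ℝ≥0∞) (τ : ℝ≥0∞) (s : Finset ℤ)
    (h : ∀ k ∈ s, ∃ r : ℕ, (2 * r + 1 : ℝ≥0∞) * τ ≤ ∑ j ∈ Finset.Icc (k - r) (k + r), F j) :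
    (s.card : ℝ≥0∞) * τ ≤ 3 * ∑' j, F j := by
  classical
  choose! r hr using h
  obtain ⟨u, hus, hdis, hcov⟩ := Vitali.exists_disjoint_subfamily_covering_enlargement
    (fun k : ℤ => (↑(Finset.Icc (k - r k) (k + r k)) : Set ℤ)) (s : Set ℤ) (fun k => (r k : ℝ)) 2
    (by norm_num) (fun a _ => by positivity) (∑ k ∈ s, (r k : ℝ))
    (fun a ha => Finset.single_le_sum (f := fun k => (r k : ℝ)) (fun _ _ => by positivity) ha)
    (fun a _ => ⟨a, by simp⟩)
  have hufin : u.Finite := s.finite_toSet.subset hus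
  set v := hufin.toFinset with hv
  have hvs : v ⊆ s := fun x hx => hus (by simpa [hv] using hx)
  -- Only the centres need covering: if two selected intervals meet and r a ≤ 2 r b, then |a - b| ≤
  -- 3 r b. The enlarged interval has 6 r b + 1 ≤ 3 (2 r b + 1) points, whence the constant 3.
  have hsub : s ⊆ v.biUnion fun b => Finset.Icc (b - 3 * r b) (b + 3 * r b) := by
    intro a ha
    obtain ⟨b, hb, ⟨x, hxa, hxb⟩, hab⟩ := hcov a ha
    have hab' : (r a : ℤ) ≤ 2 * r b := by exact_mod_cast hab
    simp only [Finset.coe_Icc, mem_Icc] at hxa hxb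
    refine Finset.mem_biUnion.2 ⟨b, by simpa [hv] using hb, Finset.mem_Icc.2 ⟨?_, ?_⟩⟩ <;> lia
  have hcard : s.card ≤ ∑ b ∈ v, 3 * (2 * r b + 1) := by
    refine (Finset.card_le_card hsub).trans (Finset.card_biUnion_le.trans ?_)
    refine Finset.sum_le_sum fun b _ => ?_
    rw [Int.card_Icc]
    lia
  have hdis' : (v : Set ℤ).PairwiseDisjoint fun k => Finset.Icc (k - r k : ℤ) (k + r k) := by
    intro a ha b hb hab
    exact Finset.disjoint_coe.1 (hdis (by simpa [hv] using ha) (by simpa [hv] using hb) hab)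
  calc (s.card : ℝ≥0∞) * τ ≤ ((∑ b ∈ v, 3 * (2 * r b + 1) : ℕ) : ℝ≥0∞) * τ := by gcongr
    _ = 3 * ∑ b ∈ v, (2 * r b + 1 : ℝ≥0∞) * τ := by
        push_cast
        rw [← Finset.mul_sum, mul_assoc, Finset.sum_mul]
    _ ≤ 3 * ∑ b ∈ v, ∑ j ∈ Finset.Icc (b - r b : ℤ) (b + r b), F j := by
        gcongr with b hb
        exact hr b (hvs hb)
    _ = 3 * ∑ j ∈ v.biUnion fun k => Finset.Icc (k - r k : ℤ) (k + r k), F j := by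
        rw [Finset.sum_biUnion hdis']
    _ ≤ 3 * ∑' j, F j := by
        gcongr
        exact ENNReal.sum_le_tsum _

/-- The weak type `(1,1)` bound of the Hardy-Littlewood maximal function on `ℤ`. -/
theorem mul_encard_le_of_average_ge (F : ℤ → ℝ≥0∞) (τ : ℝ≥0∞) (E : Set ℤ)
    (h : ∀ k ∈ E, ∃ r : ℕ, (2 * r + 1 : ℝ≥0∞) * τ ≤ ∑ j ∈ Finset.Icc (k - r) (k + r), F j) :
    τ * ((E.encard : ℕ∞) : ℝ≥0∞) ≤ 3 * ∑' j, F j := by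
  rw [mul_comm, ← ENNReal.tsum_set_const, ENNReal.tsum_eq_iSup_sum]
  refine iSup_le fun s => ?_
  have := card_mul_le_of_average_ge F τ (s.map (Function.Embedding.subtype _)) (by
    intro k hk
    obtain ⟨x, -, rfl⟩ := Finset.mem_map.1 hk
    exact h x x.2)
  simpa using this

/-- A kernel that is `O(min (1 / N, N / j ^ 2))` is controlled by dyadic averages. -/
theorem exists_dyadic_bound {w : ℤ → ℝ} {C : ℝ} {N : ℕ} (hN : 1 ≤ N) (hC : 0 ≤ C)
    (h1 : ∀ j, w j ≤ C / N) (h2 : ∀ j : ℤ, (j : ℝ) ^ 2 * w j ≤ C * N) (j : ℤ) :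
    ∃ i : ℕ, |j| ≤ 2 ^ i * N ∧ w j ≤ C * (4 * (1 / 4) ^ i / N) := by
  classical
  have hN' : (1 : ℝ) ≤ N := by exact_mod_cast hN
  have hex : ∃ i : ℕ, |j| ≤ 2 ^ i * N := by
    refine ⟨j.natAbs, ?_⟩
    have h3 : j.natAbs < 2 ^ j.natAbs := Nat.lt_two_pow_self
    have h4 : 2 ^ j.natAbs * 1 ≤ 2 ^ j.natAbs * N := Nat.mul_le_mul_left _ hN
    have h5 : j.natAbs ≤ 2 ^ j.natAbs * N := by lia
    rw [Int.abs_eq_natAbs]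
    exact_mod_cast h5
  -- With i minimal, either i = 0 and the uniform bound suffices, or |j| > 2^(i-1) N and the
  -- quadratic bound gives C / (4^(i-1) N).
  refine ⟨Nat.find hex, Nat.find_spec hex, ?_⟩
  rcases hi : Nat.find hex with _ | i
  · refine (h1 j).trans ?_
    rw [pow_zero, mul_one, mul_div_assoc', mul_comm]
    gcongr
    linarith
  · have hlt : ¬ |j| ≤ 2 ^ i * N := Nat.find_min hex (by lia)
    have hlt' : (2 ^ i * N : ℝ) < |(j : ℝ)| := by
      have : (2 ^ i * N : ℤ) < |j| := not_le.1 hlt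
      exact_mod_cast this
    have hsq : (2 ^ i * N : ℝ) ^ 2 ≤ (j : ℝ) ^ 2 := by
      rw [← sq_abs (j : ℝ)]
      gcongr
    rcases le_or_gt (w j) 0 with hw | hw
    · exact hw.trans (by positivity)
    have h3 : (2 ^ i * N : ℝ) ^ 2 * w j ≤ C * N := (by gcongr : _ ≤ (j : ℝ) ^ 2 * w j).trans (h2 j)
    have h4 : (2 ^ i * N : ℝ) ^ 2 * (C * (4 * (1 / 4) ^ (i + 1) / N)) = C * N := by
      have : ((2 : ℝ) ^ i) ^ 2 = 4 ^ i := by rw [← pow_mul, mul_comm, pow_mul]; norm_num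
      rw [mul_pow, this, pow_succ, one_div, inv_pow]
      field_simp
      ring
    rw [← h4] at h3
    exact le_of_mul_le_mul_left h3 (by positivity)

/-- A dyadic interval of radius 2^i N has at most 3 · 2^i N points and weight 4C · 4^{-i} / N, so it
contributes 12 C 2^{-i} B. The geometric series sums to 24 C B, independently of N. -/
theorem tsum_kernel_mul_le {w : ℤ → ℝ} {C : ℝ} {N : ℕ} (hN : 1 ≤ N) (hC : 0 ≤ C)
    (h1 : ∀ j, w j ≤ C / N) (h2 : ∀ j : ℤ, (j : ℝ) ^ 2 * w j ≤ C * N) (F : ℤ → ℝ≥0∞) (B : ℝ≥0∞)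
    (k : ℤ) (hB : ∀ r : ℕ, ∑ j ∈ Finset.Icc (k - r) (k + r), F j ≤ (2 * r + 1 : ℝ≥0∞) * B) :
    ∑' j, ENNReal.ofReal (w (k - j)) * F j ≤ ENNReal.ofReal (24 * C) * B := by
  classical
  have hN' : (1 : ℝ) ≤ N := by exact_mod_cast hN
  set c : ℕ → ℝ≥0∞ := fun i => ENNReal.ofReal (C * (4 * (1 / 4) ^ i / N)) with hc
  set I : ℕ → Finset ℤ := fun i => Finset.Icc (k - (2 ^ i * N : ℕ)) (k + (2 ^ i * N : ℕ)) with hI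
  have hpt : ∀ j, ENNReal.ofReal (w (k - j)) * F j ≤
      ∑' i, c i * (if j ∈ I i then F j else 0) := by
    intro j
    obtain ⟨i, hi, hw⟩ := exists_dyadic_bound hN hC h1 h2 (k - j)
    refine le_trans ?_ (ENNReal.le_tsum i)
    have : j ∈ I i := by
      rw [abs_le] at hi
      simp only [hI, Finset.mem_Icc]
      push_cast
      constructor <;> linarith [hi.1, hi.2]
    rw [if_pos this]
    gcongr
    exact ENNReal.ofReal_le_ofReal hw
  calc ∑' j, ENNReal.ofReal (w (k - j)) * F j
      ≤ ∑' j, ∑' i, c i * (if j ∈ I i then F j else 0) := ENNReal.tsum_le_tsum hpt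
    _ = ∑' i, c i * ∑ j ∈ I i, F j := by
        rw [ENNReal.tsum_comm]
        congr 1 with i
        rw [ENNReal.tsum_mul_left, tsum_eq_sum (s := I i)]
        · congr 1
          exact Finset.sum_congr rfl fun j hj => if_pos hj
        · intro j hj
          exact if_neg hj
    _ ≤ ∑' i, ENNReal.ofReal (12 * C * (1 / 2) ^ i) * B := by
        refine ENNReal.tsum_le_tsum fun i => ?_
        refine (mul_le_mul_right (hB (2 ^ i * N)) (c i)).trans ?_
        rw [← mul_assoc]
        gcongr
        have : (2 * ((2 ^ i * N : ℕ) : ℝ≥0∞) + 1) = ENNReal.ofReal (2 * (2 ^ i * N) + 1) := by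
          rw [ENNReal.ofReal_add (by positivity) (by positivity),
            ENNReal.ofReal_mul (by positivity), ENNReal.ofReal_mul (by positivity),
            ENNReal.ofReal_pow (by positivity)]
          simp
        rw [this, hc, ← ENNReal.ofReal_mul (by positivity)]
        apply ENNReal.ofReal_le_ofReal
        have h2i : (1 : ℝ) ≤ 2 ^ i * N := one_le_mul_of_one_le_of_one_le (one_le_pow₀ (by norm_num)) hN'
        calc C * (4 * (1 / 4) ^ i / N) * (2 * (2 ^ i * N) + 1)
            ≤ C * (4 * (1 / 4) ^ i / N) * (3 * (2 ^ i * N)) := by gcongr; linarith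
          _ = 12 * C * (1 / 2) ^ i := by
            have h4 : (4 : ℝ) ^ i = 2 ^ i * 2 ^ i := by rw [← mul_pow]; norm_num
            rw [one_div, one_div, inv_pow, inv_pow, h4]
            field_simp
            ring
    _ = ENNReal.ofReal (24 * C) * B := by
        rw [ENNReal.tsum_mul_right]
        congr 1
        rw [← ENNReal.ofReal_tsum_of_nonneg (fun i => by positivity)
          (summable_geometric_two.mul_left _), tsum_mul_left, tsum_geometric_two]
        ring_nf

end MaximalFunction

/-! ### Fourier series of summable sequences, convolution and inversion. -/

section Fourier

open Complex in
/-- The Fourier series of an absolutely summable sequence. -/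
noncomputable def ft (a : ℤ → ℝ) (θ : ℝ) : ℂ := ∑' k : ℤ, (a k : ℂ) * exp (k * θ * I)

theorem norm_exp_int_mul_I (k : ℤ) (θ : ℝ) : ‖Complex.exp (k * θ * Complex.I)‖ = 1 := by
  have := Complex.norm_exp_ofReal_mul_I (k * θ)
  push_cast at this
  exact this

theorem summable_ft {a : ℤ → ℝ} (ha : Summable a) (θ : ℝ) :
    Summable fun k : ℤ => ‖(a k : ℂ) * Complex.exp (k * θ * Complex.I)‖ := by
  refine ha.abs.congr fun k => ?_
  rw [norm_mul, norm_exp_int_mul_I, mul_one, Complex.norm_real, Real.norm_eq_abs]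

/-- The bijection (k, j) ↦ (k - j, j) reduces convolution to the product of two absolutely summable
families. -/
theorem summable_shear {𝕜 : Type*} [NormedRing 𝕜] [CompleteSpace 𝕜] {a b : ℤ → 𝕜}
    (ha : Summable fun k => ‖a k‖) (hb : Summable fun k => ‖b k‖) :
    Summable fun p : ℤ × ℤ => a (p.1 - p.2) * b p.2 := by
  let e : ℤ × ℤ ≃ ℤ × ℤ :=
    ⟨fun p => (p.1 - p.2, p.2), fun p => (p.1 + p.2, p.2), fun p => by simp, fun p => by simp⟩
  exact (e.summable_iff (f := fun p : ℤ × ℤ => a p.1 * b p.2)).2 (summable_mul_of_summable_norm ha hb)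

theorem tsum_shear {𝕜 : Type*} [NormedRing 𝕜] [CompleteSpace 𝕜] {a b : ℤ → 𝕜}
    (ha : Summable fun k => ‖a k‖) (hb : Summable fun k => ‖b k‖) :
    ∑' k, ∑' j, a (k - j) * b j = (∑' k, a k) * ∑' k, b k := by
  let e : ℤ × ℤ ≃ ℤ × ℤ :=
    ⟨fun p => (p.1 - p.2, p.2), fun p => (p.1 + p.2, p.2), fun p => by simp, fun p => by simp⟩
  rw [tsum_mul_tsum_of_summable_norm ha hb, ← e.tsum_eq, ← (summable_shear ha hb).tsum_prod]
  rfl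

theorem summable_conv {a b : ℤ → ℝ} (ha : Summable a) (hb : Summable b) : Summable (conv a b) := by
  have h := summable_shear (a := a) (b := b) ha.norm hb.norm
  exact h.prod

theorem ft_conv {a b : ℤ → ℝ} (ha : Summable a) (hb : Summable b) (θ : ℝ) :
    ft (conv a b) θ = ft a θ * ft b θ := by
  rw [ft, ft, ft, ← tsum_shear (summable_ft ha θ) (summable_ft hb θ)]
  congr 1 with k
  rw [conv, Complex.ofReal_tsum, ← tsum_mul_right]
  congr 1 with j
  rw [smul_eq_mul, Complex.ofReal_mul, mul_mul_mul_comm, ← Complex.exp_add]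
  congr 2
  push_cast
  ring

theorem summable_delta : Summable delta := (hasSum_pi_single 0 1).summable

theorem ft_delta (θ : ℝ) : ft delta θ = 1 := by
  rw [ft, tsum_eq_single 0]
  · simp [delta]
  · intro k hk
    simp [delta, hk]

theorem summable_convPow {a : ℤ → ℝ} (ha : Summable a) (n : ℕ) : Summable (convPow a n) := by
  induction n with
  | zero => exact summable_delta
  | succ n ih => exact summable_conv ih ha

theorem ft_convPow {a : ℤ → ℝ} (ha : Summable a) (n : ℕ) (θ : ℝ) :
    ft (convPow a n) θ = ft a θ ^ n := by
  induction n with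
  | zero => exact (ft_delta θ).trans (pow_zero _).symm
  | succ n ih => rw [convPow, ft_conv (summable_convPow ha n) ha, ih, pow_succ]

theorem ft_sub {a b : ℤ → ℝ} (ha : Summable a) (hb : Summable b) (θ : ℝ) :
    ft (a - b) θ = ft a θ - ft b θ := by
  rw [ft, ft, ft, ← (summable_ft ha θ).of_norm.tsum_sub (summable_ft hb θ).of_norm]
  congr 1 with k
  simp [sub_mul]

theorem norm_ft_le {a : ℤ → ℝ} (ha : Summable a) (θ : ℝ) : ‖ft a θ‖ ≤ ∑' k, |a k| := by
  refine (norm_tsum_le_tsum_norm (summable_ft ha θ)).trans (le_of_eq ?_)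
  congr 1 with k
  rw [norm_mul, norm_exp_int_mul_I, mul_one, Complex.norm_real, Real.norm_eq_abs]

theorem integral_exp_int (k : ℤ) :
    ∫ θ in (0 : ℝ)..(2 * Real.pi), Complex.exp (k * θ * Complex.I) =
      if k = 0 then (2 * Real.pi : ℂ) else 0 := by
  split_ifs with hk
  · simp [hk]
  · have h0 : (k : ℂ) * Complex.I ≠ 0 := by simp [hk]
    have : ∀ θ : ℝ, Complex.exp (k * θ * Complex.I) = Complex.exp (k * Complex.I * θ) := by
      intro θ; congr 1; ring
    simp_rw [this]
    rw [integral_exp_mul_complex h0]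
    have h1 : (k : ℂ) * Complex.I * ((2 * Real.pi : ℝ) : ℂ) = k * (2 * Real.pi * Complex.I) := by
      push_cast; ring
    rw [h1, Complex.exp_int_mul_two_pi_mul_I]
    simp

theorem integral_ft_mul_exp {a : ℤ → ℝ} (ha : Summable a) (x : ℤ) :
    ∫ θ in (0 : ℝ)..(2 * Real.pi), ft a θ * Complex.exp (-(x * θ * Complex.I)) =
      2 * Real.pi * a x := by
  have key : HasSum (fun k : ℤ => ∫ θ in (0 : ℝ)..(2 * Real.pi),
      (a k : ℂ) * Complex.exp ((k - x : ℤ) * θ * Complex.I))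
      (∫ θ in (0 : ℝ)..(2 * Real.pi), ft a θ * Complex.exp (-(x * θ * Complex.I))) := by
    refine intervalIntegral.hasSum_integral_of_dominated_convergence (fun k _ => |a k|)
      (fun k => (Continuous.aestronglyMeasurable (by fun_prop)))
      (fun k => .of_forall fun θ _ => ?_) (.of_forall fun θ _ => ha.abs) (by simp)
      (.of_forall fun θ _ => ?_)
    · rw [norm_mul, norm_exp_int_mul_I, mul_one, Complex.norm_real, Real.norm_eq_abs]
    · have h := (summable_ft ha θ).of_norm.hasSum.mul_right
        (Complex.exp (-(x * θ * Complex.I)))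
      refine h.congr_fun fun k => ?_
      rw [mul_assoc (a k : ℂ) (Complex.exp (k * θ * Complex.I)), ← Complex.exp_add]
      congr 2
      push_cast
      ring
  have : ∀ k : ℤ, ∫ θ in (0 : ℝ)..(2 * Real.pi),
      (a k : ℂ) * Complex.exp ((k - x : ℤ) * θ * Complex.I) =
      if k = x then (2 * Real.pi * a x : ℂ) else 0 := by
    intro k
    rw [intervalIntegral.integral_const_mul, integral_exp_int]
    by_cases hk : k = x
    · simp [hk, mul_comm]
    · simp [hk, sub_eq_zero]
  simp_rw [this] at key
  rw [← key.tsum_eq, tsum_ite_eq]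

theorem enorm_conv_le {E : Type*} [NormedAddCommGroup E] [NormedSpace ℝ E]
    (a : ℤ → ℝ) (f : ℤ → E) (k : ℤ) : ‖conv a f k‖ₑ ≤ ∑' j, ENNReal.ofReal |a (k - j)| * ‖f j‖ₑ := by
  refine enorm_tsum_le_tsum_enorm.trans (le_of_eq ?_)
  congr 1 with j
  rw [enorm_smul, ← ofReal_norm (a (k - j)), Real.norm_eq_abs]

end Fourier

/-! ### The profile S, its logarithmic derivative Q, and the scale N. -/

section Profile

/-- The profile `S(u) = ∫ u / ((1 - t) + u) dσ(t)`. -/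
noncomputable def profile (σ : Measure ℝ) (u : ℝ) : ℝ := ∫ t, u / ((1 - t) + u) ∂σ

/-- The logarithmic derivative `u S'(u)` of the profile. -/
noncomputable def profileDeriv (σ : Measure ℝ) (u : ℝ) : ℝ :=
  ∫ t, u * (1 - t) / ((1 - t) + u) ^ 2 ∂σ

variable {σ : Measure ℝ}

theorem integrable_of_bound_Ico [IsFiniteMeasure σ] {E : Type*} [NormedAddCommGroup E]
    (hσ : ∀ᵐ t ∂σ, t ∈ Ico (0 : ℝ) 1) {f : ℝ → E} (hf : AEStronglyMeasurable f σ) (C : ℝ)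
    (h : ∀ t ∈ Ico (0 : ℝ) 1, ‖f t‖ ≤ C) : Integrable f σ :=
  .of_bound hf C (hσ.mono h)

theorem profile_integrand_mem {t u : ℝ} (ht : t ∈ Ico (0 : ℝ) 1) (hu : 0 < u) :
    u / ((1 - t) + u) ∈ Icc (0 : ℝ) 1 := by
  have h1 : 0 < 1 - t := sub_pos.2 ht.2
  exact ⟨by positivity, (div_le_one (by positivity)).2 (by linarith)⟩

theorem profileDeriv_integrand_mem {t u : ℝ} (ht : t ∈ Ico (0 : ℝ) 1) (hu : 0 < u) :
    u * (1 - t) / ((1 - t) + u) ^ 2 ∈ Icc (0 : ℝ) 1 := by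
  have h1 : 0 < 1 - t := sub_pos.2 ht.2
  refine ⟨by positivity, (div_le_one (by positivity)).2 ?_⟩
  nlinarith [mul_pos hu h1, sq_nonneg u, sq_nonneg (1 - t)]

theorem integrable_profile [IsFiniteMeasure σ] (hσ : ∀ᵐ t ∂σ, t ∈ Ico (0 : ℝ) 1) {u : ℝ} (hu : 0 < u) :
    Integrable (fun t => u / ((1 - t) + u)) σ := by
  refine integrable_of_bound_Ico hσ (Measurable.aestronglyMeasurable (by fun_prop)) 1 fun t ht => ?_
  have := profile_integrand_mem ht hu
  rw [Real.norm_of_nonneg this.1]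
  exact this.2

theorem integrable_profileDeriv [IsFiniteMeasure σ] (hσ : ∀ᵐ t ∂σ, t ∈ Ico (0 : ℝ) 1) {u : ℝ} (hu : 0 < u) :
    Integrable (fun t => u * (1 - t) / ((1 - t) + u) ^ 2) σ := by
  refine integrable_of_bound_Ico hσ (Measurable.aestronglyMeasurable (by fun_prop)) 1 fun t ht => ?_
  have := profileDeriv_integrand_mem ht hu
  rw [Real.norm_of_nonneg this.1]
  exact this.2

theorem profile_nonneg (hσ : ∀ᵐ t ∂σ, t ∈ Ico (0 : ℝ) 1) {u : ℝ} (hu : 0 < u) :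
    0 ≤ profile σ u :=
  integral_nonneg_of_ae (hσ.mono fun _ ht => (profile_integrand_mem ht hu).1)

theorem profileDeriv_nonneg (hσ : ∀ᵐ t ∂σ, t ∈ Ico (0 : ℝ) 1) {u : ℝ} (hu : 0 < u) :
    0 ≤ profileDeriv σ u :=
  integral_nonneg_of_ae (hσ.mono fun _ ht => (profileDeriv_integrand_mem ht hu).1)

theorem profile_mono [IsFiniteMeasure σ] (hσ : ∀ᵐ t ∂σ, t ∈ Ico (0 : ℝ) 1) {u v : ℝ} (hu : 0 < u) (huv : u ≤ v) :
    profile σ u ≤ profile σ v := by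
  refine integral_mono_ae (integrable_profile hσ hu) (integrable_profile hσ (hu.trans_le huv))
    (hσ.mono fun t ht => ?_)
  have h1 : 0 < 1 - t := sub_pos.2 ht.2
  have h2 : 0 < v := hu.trans_le huv
  rw [div_le_div_iff₀ (by positivity) (by positivity)]
  nlinarith

/-- S grows at most linearly: the numerator gains at most a factor c and the denominator does not
decrease. -/
theorem profile_le_mul [IsFiniteMeasure σ] (hσ : ∀ᵐ t ∂σ, t ∈ Ico (0 : ℝ) 1) {u v c : ℝ} (hu : 0 < u) (huv : u ≤ v)
    (hc : v ≤ c * u) : profile σ v ≤ c * profile σ u := by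
  rw [profile, profile, ← integral_const_mul]
  refine integral_mono_ae (integrable_profile hσ (hu.trans_le huv))
    ((integrable_profile hσ hu).const_mul c) (hσ.mono fun t ht => ?_)
  have h1 : 0 < 1 - t := sub_pos.2 ht.2
  have h2 : 0 < v := hu.trans_le huv
  show v / ((1 - t) + v) ≤ c * (u / ((1 - t) + u))
  rw [mul_div_assoc']
  have h3 : 0 ≤ c * u := h2.le.trans hc
  gcongr

/-- Q need not be monotone, but the denominators at u and v differ by at most c², which lets a bound
at the points 1/n pass to every u. -/
theorem profileDeriv_le_mul [IsFiniteMeasure σ] (hσ : ∀ᵐ t ∂σ, t ∈ Ico (0 : ℝ) 1) {u v c : ℝ} (hu : 0 < u)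
    (huv : u ≤ v) (hc1 : 1 ≤ c) (hc : v ≤ c * u) :
    profileDeriv σ u ≤ c ^ 2 * profileDeriv σ v := by
  rw [profileDeriv, profileDeriv, ← integral_const_mul]
  refine integral_mono_ae (integrable_profileDeriv hσ hu)
    ((integrable_profileDeriv hσ (hu.trans_le huv)).const_mul _) (hσ.mono fun t ht => ?_)
  have h1 : 0 < 1 - t := sub_pos.2 ht.2
  have h2 : 0 < v := hu.trans_le huv
  show u * (1 - t) / ((1 - t) + u) ^ 2 ≤ c ^ 2 * (v * (1 - t) / ((1 - t) + v) ^ 2)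
  have h3 : (1 - t) + v ≤ c * ((1 - t) + u) := by nlinarith
  calc u * (1 - t) / ((1 - t) + u) ^ 2 = c ^ 2 * (u * (1 - t)) / (c * ((1 - t) + u)) ^ 2 := by
        have : c ≠ 0 := by positivity
        field_simp
    _ ≤ c ^ 2 * (v * (1 - t)) / ((1 - t) + v) ^ 2 := by gcongr
    _ = _ := by ring

/-- Since σ does not charge 1, dominated convergence applies. This kills ψ and ψ' at the endpoints
in the integrations by parts. -/
theorem tendsto_profile [IsFiniteMeasure σ] (hσ : ∀ᵐ t ∂σ, t ∈ Ico (0 : ℝ) 1) :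
    Filter.Tendsto (profile σ) (nhdsWithin 0 (Ioi 0)) (nhds 0) := by
  have h : Filter.Tendsto (profile σ) (nhdsWithin 0 (Ioi 0)) (nhds (∫ _, (0 : ℝ) ∂σ)) := by
    refine tendsto_integral_filter_of_dominated_convergence (fun _ => 1) ?_ ?_
      (integrable_const _) ?_
    · exact .of_forall fun u => Measurable.aestronglyMeasurable (by fun_prop)
    · filter_upwards [self_mem_nhdsWithin] with u hu
      filter_upwards [hσ] with t ht
      have := profile_integrand_mem ht hu
      rw [Real.norm_of_nonneg this.1]
      exact this.2
    · filter_upwards [hσ] with t ht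
      have h1 : 0 < 1 - t := sub_pos.2 ht.2
      have : ContinuousAt (fun u : ℝ => u / ((1 - t) + u)) 0 :=
        continuousAt_id.div (by fun_prop) (by simpa using h1.ne')
      have h2 := this.tendsto
      simp only [zero_div] at h2
      exact h2.mono_left nhdsWithin_le_nhds
  simpa using h

/-- The antiderivative is θ/(s + θ). It serves with s = 1 - t, to integrate S', and with s = 1/N, to
integrate the majorant of the symbols. -/
theorem lintegral_div_add_sq {s d : ℝ} (hs : 0 < s) (hd : 0 < d) :
    ∫⁻ θ in Ioc 0 d, ENNReal.ofReal (s / (s + θ) ^ 2) = ENNReal.ofReal (d / (s + d)) := by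
  have hpos : ∀ θ ∈ uIcc 0 d, s + θ ≠ 0 := by
    intro θ hθ
    rw [uIcc_of_le hd.le] at hθ
    linarith [hθ.1]
  have hcont : ContinuousOn (fun θ => s / (s + θ) ^ 2) (uIcc 0 d) :=
    continuousOn_const.div (by fun_prop) fun θ hθ => pow_ne_zero _ (hpos θ hθ)
  have hii := hcont.intervalIntegrable (μ := volume)
  have hFTC : ∫ θ in (0 : ℝ)..d, s / (s + θ) ^ 2 = d / (s + d) := by
    rw [intervalIntegral.integral_eq_sub_of_hasDerivAt (f := fun θ => θ / (s + θ)) _ hii]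
    · simp
    · intro θ hθ
      convert! (hasDerivAt_id θ).div ((hasDerivAt_id θ).const_add s) (hpos θ hθ) using 1
      simp
  rw [← hFTC, intervalIntegral.integral_of_le hd.le, ofReal_integral_eq_lintegral_ofReal]
  · exact (intervalIntegrable_iff_integrableOn_Ioc_of_le hd.le).1 hii
  · exact .of_forall fun θ => div_nonneg hs.le (sq_nonneg _)

/-- `∫_0^δ S'(θ) dθ ≤ S(δ)`. -/
theorem lintegral_profileDeriv_div_le [IsFiniteMeasure σ] (hσ : ∀ᵐ t ∂σ, t ∈ Ico (0 : ℝ) 1) {δ : ℝ} (hδ : 0 < δ) :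
    ∫⁻ θ in Ioc 0 δ, ENNReal.ofReal (profileDeriv σ θ / θ) ≤ ENNReal.ofReal (profile σ δ) := by
  have h1 : ∀ θ ∈ Ioc 0 δ, ENNReal.ofReal (profileDeriv σ θ / θ) =
      ∫⁻ t, ENNReal.ofReal ((1 - t) / ((1 - t) + θ) ^ 2) ∂σ := by
    intro θ hθ
    rw [profileDeriv, ← integral_div, ofReal_integral_eq_lintegral_ofReal
      ((integrable_profileDeriv hσ hθ.1).div_const _)
      (hσ.mono fun t ht => div_nonneg (profileDeriv_integrand_mem ht hθ.1).1 hθ.1.le)]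
    congr 1 with t
    congr 1
    have := hθ.1.ne'
    rw [div_right_comm, mul_div_cancel_left₀ _ this]
  rw [setLIntegral_congr_fun measurableSet_Ioc h1, lintegral_lintegral_swap (by fun_prop), profile,
    ofReal_integral_eq_lintegral_ofReal (integrable_profile hσ hδ)
      (hσ.mono fun t ht => (profile_integrand_mem ht hδ).1)]
  refine lintegral_mono_ae (hσ.mono fun t ht => ?_)
  exact (lintegral_div_add_sq (sub_pos.2 ht.2) hδ).le

theorem measurable_profileDeriv [IsFiniteMeasure σ] : Measurable (profileDeriv σ) := by
  have : Measurable fun p : ℝ × ℝ => p.1 * (1 - p.2) / ((1 - p.2) + p.1) ^ 2 := by fun_prop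
  exact this.stronglyMeasurable.integral_prod_right'.measurable

/-- The scale `1 / N` at which `n u S(u)` becomes of order one. -/
theorem exists_scale [IsFiniteMeasure σ] (hσ : ∀ᵐ t ∂σ, t ∈ Ico (0 : ℝ) 1) (n : ℕ) :
    ∃ N : ℕ, 1 ≤ N ∧ n * (1 / N * profile σ (1 / N)) ≤ 1 ∧
      (N = 1 ∨ 1 / 4 ≤ n * (1 / N * profile σ (1 / N))) := by
  classical
  have hex : ∃ N : ℕ, 1 ≤ N ∧ n * (1 / N * profile σ (1 / N)) ≤ 1 := by
    have h1 := profile_nonneg hσ one_pos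
    refine ⟨⌈n * profile σ 1⌉₊ + 1, Nat.le_add_left _ _, ?_⟩
    have h2 := Nat.le_ceil (n * profile σ 1)
    set M := ⌈n * profile σ 1⌉₊
    have h4 : (1 : ℝ) / (M + 1 : ℕ) ≤ 1 := by
      push_cast
      exact (div_le_one (by positivity)).2 (by linarith [(Nat.cast_nonneg M : (0 : ℝ) ≤ M)])
    have h3 := profile_mono hσ (u := 1 / (M + 1 : ℕ)) (v := 1) (by positivity) h4
    calc _ ≤ n * (1 / (M + 1 : ℕ) * profile σ 1) := by gcongr
      _ = n * profile σ 1 / (M + 1 : ℕ) := by ring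
      _ ≤ 1 := (div_le_one (by positivity)).2 (by push_cast; linarith)
  obtain ⟨h1, h2⟩ := Nat.find_spec hex
  refine ⟨Nat.find hex, h1, h2, ?_⟩
  rcases hN : Nat.find hex with _ | M
  · lia
  rcases Nat.eq_zero_or_pos M with rfl | hM
  · exact Or.inl rfl
  right
  -- Minimality of M + 1 makes the quantity exceed 1 at 1/M. Passing to 1/(M+1) loses at most a
  -- factor 2 in u and a factor 2 in S(u), which leaves 1/4.
  have h3 : ¬ (1 ≤ M ∧ n * (1 / M * profile σ (1 / M)) ≤ 1) := Nat.find_min hex (by lia)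
  have h4 : 1 < n * (1 / M * profile σ (1 / M)) := by
    by_contra h
    exact h3 ⟨hM, not_lt.1 h⟩
  have hM' : (1 : ℝ) ≤ M := by exact_mod_cast hM
  have h5 : (1 : ℝ) / M ≤ 2 * (1 / (M + 1 : ℕ)) := by
    rw [mul_one_div, div_le_div_iff₀ (by positivity) (by positivity)]
    push_cast
    linarith
  have h6 : (1 : ℝ) / (M + 1 : ℕ) ≤ 1 / M := by
    gcongr
    simp
  have h7 := profile_le_mul hσ (by positivity) h6 h5
  have h8 := profile_nonneg hσ (u := 1 / (M + 1 : ℕ)) (by positivity)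
  have h10 := profile_nonneg hσ (u := 1 / M) (by positivity)
  have h9 : n * (1 / M * profile σ (1 / M)) ≤
      n * (2 * (1 / (M + 1 : ℕ)) * (2 * profile σ (1 / (M + 1 : ℕ)))) := by
    gcongr
  nlinarith

end Profile

/-! ### From the tail condition on μ to the comparison S ≤ A Q. -/

section Representation

/-- The finite measure `t / (1 - t)² ν(dt)`. -/
noncomputable def tilt (ν : Measure ℝ) : Measure ℝ :=
  ν.withDensity fun t => ENNReal.ofReal (t / (1 - t) ^ 2)

variable {μ : Measure ℤ} {ν : Measure ℝ}

theorem IsCCM.ae_mem (h : IsCCM μ ν) : ∀ᵐ t ∂ν, t ∈ Ico (0 : ℝ) 1 := by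
  have h1 : ∀ᵐ t ∂ν, t ∈ Icc (0 : ℝ) 1 := h.unit_interval
  have h2 : ∀ᵐ t ∂ν, 1 / ENNReal.ofReal (1 - t) ^ 2 < ∞ :=
    ae_lt_top (by fun_prop) (by rw [h.normalized]; exact ENNReal.one_ne_top)
  filter_upwards [h1, h2] with t ht1 ht2
  refine ⟨ht1.1, lt_of_le_of_ne ht1.2 ?_⟩
  rintro rfl
  simp at ht2

theorem IsCCM.lintegral_inv_sq (h : IsCCM μ ν) :
    ∫⁻ t, ENNReal.ofReal (1 / (1 - t) ^ 2) ∂ν = 1 := by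
  rw [← h.normalized]
  refine lintegral_congr_ae (h.ae_mem.mono fun t ht => ?_)
  have h1 : 0 < 1 - t := sub_pos.2 ht.2
  show ENNReal.ofReal (1 / (1 - t) ^ 2) = 1 / ENNReal.ofReal (1 - t) ^ 2
  rw [ENNReal.ofReal_div_of_pos (by positivity), ENNReal.ofReal_pow h1.le, ENNReal.ofReal_one]

theorem IsCCM.integrable_inv_sq (h : IsCCM μ ν) : Integrable (fun t => 1 / (1 - t) ^ 2) ν := by
  refine ⟨Measurable.aestronglyMeasurable (by fun_prop), ?_⟩
  rw [hasFiniteIntegral_iff_ofReal (.of_forall fun t => by positivity), h.lintegral_inv_sq]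
  exact ENNReal.one_lt_top

theorem IsCCM.integrable_of_le (h : IsCCM μ ν) {E : Type*} [NormedAddCommGroup E] {f : ℝ → E}
    (hf : AEStronglyMeasurable f ν) (C : ℝ)
    (hC : ∀ t ∈ Ico (0 : ℝ) 1, ‖f t‖ ≤ C * (1 / (1 - t) ^ 2)) : Integrable f ν :=
  (h.integrable_inv_sq.const_mul C).mono' hf (h.ae_mem.mono hC)

theorem IsCCM.measure_univ_pos (h : IsCCM μ ν) : 0 < ν univ := by
  refine pos_iff_ne_zero.2 fun h0 => ?_
  have := h.normalized
  rw [Measure.measure_univ_eq_zero.1 h0, lintegral_zero_measure] at this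
  exact zero_ne_one this

/-- The atom at 0 is the constant in the exponential decay of the powers of the Fourier transform.
-/
theorem IsCCM.mass_zero_pos (h : IsCCM μ ν) : 0 < mass μ 0 := by
  have := h.finite
  have h0 := h.nat_mass 0
  simp only [Nat.cast_zero, pow_zero, integral_const, smul_eq_mul, mul_one] at h0
  rw [h0]
  exact ENNReal.toReal_pos h.measure_univ_pos.ne' (measure_ne_top _ _)

theorem IsCCM.ae_tilt_mem (h : IsCCM μ ν) : ∀ᵐ t ∂tilt ν, t ∈ Ico (0 : ℝ) 1 :=
  (withDensity_absolutelyContinuous _ _).ae_le h.ae_mem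

theorem IsCCM.isFiniteMeasure_tilt (h : IsCCM μ ν) : IsFiniteMeasure (tilt ν) := by
  refine isFiniteMeasure_withDensity (ne_top_of_le_ne_top ENNReal.one_ne_top ?_)
  rw [← h.lintegral_inv_sq]
  refine lintegral_mono_ae (h.ae_mem.mono fun t ht => ?_)
  have := ht.2.le
  exact ENNReal.ofReal_le_ofReal (by gcongr)

theorem IsCCM.integral_tilt (h : IsCCM μ ν) {E : Type*} [NormedAddCommGroup E] [NormedSpace ℝ E]
    (f : ℝ → E) : ∫ t, f t ∂tilt ν = ∫ t, (t / (1 - t) ^ 2) • f t ∂ν := by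
  rw [tilt, integral_withDensity_eq_integral_toReal_smul (by fun_prop)
    (.of_forall fun _ => ENNReal.ofReal_lt_top)]
  refine integral_congr_ae (h.ae_mem.mono fun t ht => ?_)
  have := ht.1
  show (ENNReal.ofReal (t / (1 - t) ^ 2)).toReal • f t = _
  rw [ENNReal.toReal_ofReal (by positivity)]

theorem IsCCM.integrable_pow (h : IsCCM μ ν) (k : ℕ) : Integrable (fun t => t ^ k) ν := by
  refine h.integrable_of_le (Measurable.aestronglyMeasurable (by fun_prop)) 1 fun t ht => ?_
  have h1 : 0 < 1 - t := sub_pos.2 ht.2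
  rw [norm_pow, Real.norm_of_nonneg ht.1, one_mul]
  refine (pow_le_one₀ ht.1 ht.2.le).trans ((one_le_div (by positivity)).2 ?_)
  exact pow_le_one₀ h1.le (by linarith [ht.1])

/-- Put k = n + j and use n + j ≥ j + 1: the series is at least t^n ∑ (j+1) t^j. -/
theorem tsum_subtype_mul_pow_ge {t : ℝ} (ht : t ∈ Ico (0 : ℝ) 1) {n : ℕ} (hn : 1 ≤ n) :
    t ^ n / (1 - t) ^ 2 ≤ ∑' k : {k : ℕ // n ≤ k}, ((k : ℕ) : ℝ) * t ^ (k : ℕ) := by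
  have ht' : ‖t‖ < 1 := by rw [Real.norm_of_nonneg ht.1]; exact ht.2
  let e : ℕ ≃ {k : ℕ // n ≤ k} :=
    ⟨fun j => ⟨n + j, Nat.le_add_right _ _⟩, fun k => k - n, fun j => by simp,
      fun k => by ext; simp [k.2]⟩
  rw [← e.tsum_eq]
  have h0 := (hasSum_coe_mul_geometric_of_norm_lt_one ht').summable
  have h1 := hasSum_geometric_of_norm_lt_one ht'
  have h2 := hasSum_coe_mul_geometric_of_norm_lt_one ht'
  have h3 : 1 - t ≠ 0 := (sub_pos.2 ht.2).ne'
  have h4 : HasSum (fun j : ℕ => t ^ n * (j * t ^ j + t ^ j)) (t ^ n / (1 - t) ^ 2) := by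
    convert! (h2.add h1).mul_left (t ^ n) using 1
    field_simp
    ring
  refine hasSum_le (fun j => ?_) h4 (Summable.hasSum ?_)
  · show t ^ n * (j * t ^ j + t ^ j) ≤ ((n + j : ℕ) : ℝ) * t ^ (n + j)
    have hn' : (1 : ℝ) ≤ n := by exact_mod_cast hn
    push_cast
    rw [pow_add]
    have h5 : 0 ≤ t ^ n * t ^ j := mul_nonneg (pow_nonneg ht.1 _) (pow_nonneg ht.1 _)
    nlinarith
  · show Summable fun j => ((n + j : ℕ) : ℝ) * t ^ (n + j)
    simp_rw [Nat.add_comm n]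
    exact (summable_nat_add_iff n).2 h0

theorem sum_sq_mul_pow_eq (t : ℝ) (n : ℕ) :
    ∑ k ∈ Finset.Icc 1 n, (k : ℝ) ^ 2 * t ^ k =
      t * ∑ i ∈ Finset.range n, ((i : ℝ) + 1) ^ 2 * t ^ i := by
  rw [show Finset.Icc 1 n = Finset.Ico 1 (n + 1) by ext; simp, Finset.sum_Ico_eq_sum_range,
    Finset.mul_sum]
  refine Finset.sum_congr rfl fun i _ => ?_
  push_cast
  ring

/-- From (i+1)² ≤ (i+1)(i+2) = 2 · choose (i+2) 2 and the generating function of the binomial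
coefficients. This is the bound for t far from 1; `sum_sq_mul_pow_le_cube` covers t near 1. -/
theorem sum_sq_mul_pow_le {t : ℝ} (ht : t ∈ Ico (0 : ℝ) 1) (n : ℕ) :
    ∑ k ∈ Finset.Icc 1 n, (k : ℝ) ^ 2 * t ^ k ≤ t * (2 / (1 - t) ^ 3) := by
  have ht' : ‖t‖ < 1 := by rw [Real.norm_of_nonneg ht.1]; exact ht.2
  have ht0 := ht.1
  have h1 : HasSum (fun i : ℕ => 2 * (((i + 2).choose 2 : ℝ) * t ^ i)) (2 / (1 - t) ^ 3) := by
    convert! (hasSum_choose_mul_geometric_of_norm_lt_one 2 ht').mul_left 2 using 1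
    ring
  rw [sum_sq_mul_pow_eq]
  refine mul_le_mul_of_nonneg_left ?_ ht0
  refine le_trans (Finset.sum_le_sum fun i _ => ?_)
    (sum_le_hasSum (Finset.range n) (fun i _ => by positivity) h1)
  rw [Nat.cast_choose_two, ← mul_assoc]
  gcongr
  push_cast
  nlinarith [(Nat.cast_nonneg i : (0 : ℝ) ≤ i)]

theorem sum_sq_mul_pow_le_cube {t : ℝ} (ht : t ∈ Ico (0 : ℝ) 1) (n : ℕ) :
    ∑ k ∈ Finset.Icc 1 n, (k : ℝ) ^ 2 * t ^ k ≤ t * (n : ℝ) ^ 3 := by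
  have ht0 := ht.1
  rw [sum_sq_mul_pow_eq]
  refine mul_le_mul_of_nonneg_left ?_ ht0
  calc ∑ i ∈ Finset.range n, ((i : ℝ) + 1) ^ 2 * t ^ i ≤ ∑ i ∈ Finset.range n, (n : ℝ) ^ 2 := by
        refine Finset.sum_le_sum fun i hi => ?_
        have h1 : (i : ℝ) + 1 ≤ n := by exact_mod_cast Finset.mem_range.1 hi
        calc ((i : ℝ) + 1) ^ 2 * t ^ i ≤ (n : ℝ) ^ 2 * 1 := by
              have := pow_le_one₀ (n := i) ht0 ht.2.le
              gcongr
          _ = (n : ℝ) ^ 2 := mul_one _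
    _ = (n : ℝ) ^ 3 := by
        rw [Finset.sum_const, Finset.card_range, nsmul_eq_mul]
        ring

/-- With u = 1/n the right side is 8t / ((1-t)((1-t)+u)²). It is at least 2t/(1-t)³ when u ≤ 1-t,
and at least 2t n³ otherwise. -/
theorem sum_sq_mul_pow_le_profileDeriv {t : ℝ} (ht : t ∈ Ico (0 : ℝ) 1) {n : ℕ} (hn : 1 ≤ n) :
    ∑ k ∈ Finset.Icc 1 n, (k : ℝ) ^ 2 * t ^ k ≤
      8 * n * (t / (1 - t) ^ 2 * (1 / n * (1 - t) / ((1 - t) + 1 / n) ^ 2)) := by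
  have ht0 := ht.1
  have hs : 0 < 1 - t := sub_pos.2 ht.2
  have hn' : (0 : ℝ) < n := by exact_mod_cast hn
  obtain ⟨u, hu, hnu⟩ : ∃ u : ℝ, 0 < u ∧ (n : ℝ) = 1 / u := ⟨1 / n, by positivity, by simp⟩
  have e : 8 * (n : ℝ) * (t / (1 - t) ^ 2 * (1 / n * (1 - t) / ((1 - t) + 1 / n) ^ 2)) =
      t * (8 / ((1 - t) * ((1 - t) + u) ^ 2)) := by
    rw [hnu, one_div_one_div]
    field_simp
  rw [e]
  rcases le_total u (1 - t) with h | h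
  · refine (sum_sq_mul_pow_le ht n).trans (mul_le_mul_of_nonneg_left ?_ ht0)
    rw [div_le_div_iff₀ (by positivity) (by positivity)]
    have : ((1 - t) + u) ^ 2 ≤ (2 * (1 - t)) ^ 2 := by gcongr; linarith
    nlinarith [mul_le_mul_of_nonneg_left this hs.le]
  · refine (sum_sq_mul_pow_le_cube ht n).trans (mul_le_mul_of_nonneg_left ?_ ht0)
    rw [hnu, one_div_pow, div_le_div_iff₀ (by positivity) (by positivity)]
    have : (1 - t) * ((1 - t) + u) ^ 2 ≤ u * (2 * u) ^ 2 := by gcongr; linarith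
    nlinarith [pow_pos hu 3]

/-- Put u = 1/n. If 1 - t ≤ u/2, Bernoulli's inequality gives t^(n-1) ≥ 1/2, so the first term is at
least 1. Otherwise (1-t) + u ≤ 3(1-t), and the second term suffices. -/
theorem profile_integrand_le {t : ℝ} (ht : t ∈ Ico (0 : ℝ) 1) {n : ℕ} (hn : 1 ≤ n) :
    1 / n / ((1 - t) + 1 / n) ≤
      2 * t ^ (n - 1) + 3 * (1 / n * (1 - t) / ((1 - t) + 1 / n) ^ 2) := by
  have ht0 := ht.1
  have hs : 0 < 1 - t := sub_pos.2 ht.2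
  have hn' : (1 : ℝ) ≤ n := by exact_mod_cast hn
  obtain ⟨u, hu, hnu⟩ : ∃ u : ℝ, 0 < u ∧ (n : ℝ) = 1 / u := ⟨1 / n, by positivity, by simp⟩
  have hun : 1 / (n : ℝ) = u := by rw [hnu, one_div_one_div]
  rw [hun]
  rcases le_total (2 * (1 - t)) u with h | h
  · have h1 := one_add_mul_le_pow (a := t - 1) (by linarith) (n - 1)
    rw [Nat.cast_sub hn, add_sub_cancel] at h1
    have h2 : (n : ℝ) * (1 - t) ≤ 1 / 2 := by
      rw [hnu, div_mul_eq_mul_div, div_le_div_iff₀ hu two_pos]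
      linarith
    have h3 : u / ((1 - t) + u) ≤ 1 := (div_le_one (by positivity)).2 (by linarith)
    have h4 : 0 ≤ u * (1 - t) / ((1 - t) + u) ^ 2 := by positivity
    push_cast at h1
    nlinarith
  · have h1 : u / ((1 - t) + u) ≤ 3 * (u * (1 - t) / ((1 - t) + u) ^ 2) := by
      rw [mul_div_assoc', div_le_div_iff₀ (by positivity) (by positivity)]
      have : 0 ≤ u * ((1 - t) + u) * (2 * (1 - t) - u) := by
        have : 0 ≤ 2 * (1 - t) - u := by linarith
        positivity
      nlinarith
    have : 0 ≤ t ^ (n - 1) := pow_nonneg ht0 _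
    linarith

/-- Partial sums are bounded by ∑ k t^k = t/(1-t)², which is ν-integrable by the normalization. -/
theorem IsCCM.summable_first_moment (h : IsCCM μ ν) :
    Summable fun k : ℕ => ∫ t, ‖(k : ℝ) * t ^ k‖ ∂ν := by
  refine summable_of_sum_range_le (c := ∫ t, 1 / (1 - t) ^ 2 ∂ν)
    (fun k => integral_nonneg fun t => norm_nonneg _) fun n => ?_
  rw [← integral_finsetSum _ fun k _ => ((h.integrable_pow k).const_mul _).norm]
  refine integral_mono_ae (integrable_finsetSum _ fun k _ => ((h.integrable_pow k).const_mul _).norm)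
    h.integrable_inv_sq (h.ae_mem.mono fun t ht => ?_)
  have ht' : ‖t‖ < 1 := by rw [Real.norm_of_nonneg ht.1]; exact ht.2
  have ht0 := ht.1
  have h1 := hasSum_coe_mul_geometric_of_norm_lt_one ht'
  have h2 : ∑ k ∈ Finset.range n, ‖(k : ℝ) * t ^ k‖ = ∑ k ∈ Finset.range n, (k : ℝ) * t ^ k :=
    Finset.sum_congr rfl fun k _ => Real.norm_of_nonneg (by positivity)
  show ∑ k ∈ Finset.range n, ‖(k : ℝ) * t ^ k‖ ≤ 1 / (1 - t) ^ 2
  rw [h2]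
  refine (sum_le_hasSum _ (fun k _ => by positivity) h1).trans ?_
  have := ht.2.le
  gcongr

theorem IsCCM.integral_pow_tilt_le (h : IsCCM μ ν) {n : ℕ} (hn : 1 ≤ n) :
    ∫ t, t ^ (n - 1) ∂tilt ν ≤ ∑' k : {k : ℕ // n ≤ k}, ((k : ℕ) : ℝ) * mass μ (k : ℕ) := by
  have h1 := hasSum_integral_of_summable_integral_norm
    (F := fun (k : {k : ℕ // n ≤ k}) (t : ℝ) => ((k : ℕ) : ℝ) * t ^ (k : ℕ))
    (fun k => (h.integrable_pow k).const_mul _) (h.summable_first_moment.subtype _)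
  simp_rw [integral_const_mul, ← h.nat_mass] at h1
  have hle : ∀ t ∈ Ico (0 : ℝ) 1,
      ∑' k : {k : ℕ // n ≤ k}, ((k : ℕ) : ℝ) * t ^ (k : ℕ) ≤ 1 / (1 - t) ^ 2 := by
    intro t ht
    have ht' : ‖t‖ < 1 := by rw [Real.norm_of_nonneg ht.1]; exact ht.2
    have h2 := hasSum_coe_mul_geometric_of_norm_lt_one ht'
    have := ht.1
    have h3 := h2.summable.tsum_subtype_le (fun k : ℕ => (k : ℝ) * t ^ k) {k | n ≤ k}
      (fun k => by positivity)
    refine h3.trans (h2.tsum_eq.trans_le ?_)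
    have := ht.2.le
    gcongr
  rw [h1.tsum_eq, h.integral_tilt]
  refine integral_mono_ae ?_ ?_ (h.ae_mem.mono fun t ht => ?_)
  · refine h.integrable_of_le (Measurable.aestronglyMeasurable (by fun_prop)) 1 fun t ht => ?_
    have := ht.1
    have h4 := ht.2.le
    have h5 := pow_le_one₀ (n := n - 1) ht.1 ht.2.le
    rw [smul_eq_mul, Real.norm_of_nonneg (by positivity), one_mul, ← mul_one (1 / (1 - t) ^ 2)]
    gcongr
  · refine h.integrable_of_le ?_ 1 fun t ht => ?_
    · exact (Measurable.tsum (fun k => by fun_prop)).aestronglyMeasurable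
    · have := ht.1
      rw [one_mul, Real.norm_of_nonneg (tsum_nonneg fun k => by positivity)]
      exact hle t ht
  · refine le_trans (le_of_eq ?_) (tsum_subtype_mul_pow_ge ht hn)
    show t / (1 - t) ^ 2 * t ^ (n - 1) = t ^ n / (1 - t) ^ 2
    obtain ⟨n, rfl⟩ := Nat.exists_eq_add_of_le' hn
    simp only [Nat.add_sub_cancel]
    ring

theorem IsCCM.sum_sq_mass_le (h : IsCCM μ ν) {n : ℕ} (hn : 1 ≤ n) :
    ∑ k ∈ Finset.Icc 1 n, (k : ℝ) ^ 2 * mass μ (k : ℕ) ≤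
      8 * n * profileDeriv (tilt ν) (1 / n) := by
  have hn' : (0 : ℝ) < n := by exact_mod_cast hn
  simp_rw [h.nat_mass, ← integral_const_mul]
  rw [← integral_finsetSum _ fun k _ => (h.integrable_pow k).const_mul _, profileDeriv,
    h.integral_tilt, ← integral_const_mul]
  refine integral_mono_ae (integrable_finsetSum _ fun k _ => (h.integrable_pow k).const_mul _)
    (Integrable.const_mul ?_ _) (h.ae_mem.mono fun t ht => sum_sq_mul_pow_le_profileDeriv ht hn)
  refine h.integrable_of_le (Measurable.aestronglyMeasurable (by fun_prop)) 1 fun t ht => ?_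
  have h1 := profileDeriv_integrand_mem ht (u := 1 / n) (by positivity)
  have h2 := ht.1
  have h3 := ht.2.le
  have h4 : 0 ≤ t / (1 - t) ^ 2 := by positivity
  rw [smul_eq_mul, norm_mul, Real.norm_of_nonneg h1.1, Real.norm_of_nonneg h4, one_mul,
    ← mul_one (1 / (1 - t) ^ 2)]
  exact mul_le_mul (by gcongr) h1.2 h1.1 (by positivity)

/-- The tail condition says that the profile is comparable with its logarithmic derivative. -/
theorem IsCCM.profile_le_profileDeriv (h : IsCCM μ ν) {L : ℝ} (hL0 : 0 < L)
    (hL : ∀ n : ℕ, (n : ℝ) * ∑' k : {k : ℕ // n ≤ k}, (k : ℝ) * mass μ (k : ℕ) ≤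
      L * ∑ k ∈ Finset.Icc 1 n, (k : ℝ) ^ 2 * mass μ (k : ℕ)) {u : ℝ} (hu : 0 < u) (hu4 : u ≤ 4) :
    profile (tilt ν) u ≤ 64 * (16 * L + 3) * profileDeriv (tilt ν) u := by
  have hfin := h.isFiniteMeasure_tilt
  have hσ := h.ae_tilt_mem
  -- Take n = ⌈1/u⌉. The ratio of u to 1/n is at most 2 when n ≥ 2, and at most 4 when n = 1 since u
  -- ≤ 4.
  obtain ⟨n, hn, h1, h2⟩ : ∃ n : ℕ, 1 ≤ n ∧ 1 / (n : ℝ) ≤ u ∧ u ≤ 4 * (1 / n) := by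
    have hc : 1 ≤ ⌈1 / u⌉₊ := Nat.one_le_ceil_iff.2 (by positivity)
    have hc' : (1 : ℝ) ≤ ⌈1 / u⌉₊ := by exact_mod_cast hc
    refine ⟨⌈1 / u⌉₊, hc, ?_, ?_⟩
    · rw [one_div_le (by positivity) hu]
      exact Nat.le_ceil _
    · rw [mul_one_div, le_div_iff₀ (by positivity)]
      rcases hc.eq_or_lt with h1 | h1
      · rw [← h1]
        simpa using hu4
      · have h3 : (2 : ℝ) ≤ ⌈1 / u⌉₊ := by exact_mod_cast h1
        have h4 : (⌈1 / u⌉₊ : ℝ) < 1 / u + 1 := Nat.ceil_lt_add_one (by positivity)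
        have h5 : u * (⌈1 / u⌉₊ : ℝ) ≤ u * (2 * (1 / u)) := by gcongr; linarith
        have h6 : u * (2 * (1 / u)) = 2 := by field_simp
        linarith
  have hn' : (0 : ℝ) < n := by exact_mod_cast hn
  have hv : (0 : ℝ) < 1 / n := by positivity
  -- Integrating `profile_integrand_le` against σ gives S ≤ 2 ∫ t^(n-1) dσ + 3Q at 1/n, and the tail
  -- condition bounds the integral by 8LQ.
  have hmain : profile (tilt ν) (1 / n) ≤ (16 * L + 3) * profileDeriv (tilt ν) (1 / n) := by
    have h3 : (n : ℝ) * ∫ t, t ^ (n - 1) ∂tilt ν ≤ n * (8 * L * profileDeriv (tilt ν) (1 / n)) :=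
      calc (n : ℝ) * ∫ t, t ^ (n - 1) ∂tilt ν ≤ _ :=
            mul_le_mul_of_nonneg_left (h.integral_pow_tilt_le hn) hn'.le
        _ ≤ _ := hL n
        _ ≤ L * (8 * n * profileDeriv (tilt ν) (1 / n)) :=
            mul_le_mul_of_nonneg_left (h.sum_sq_mass_le hn) hL0.le
        _ = _ := by ring
    have h4 := le_of_mul_le_mul_left h3 hn'
    have hi1 : Integrable (fun t : ℝ => t ^ (n - 1)) (tilt ν) := by
      refine integrable_of_bound_Ico hσ (Measurable.aestronglyMeasurable (by fun_prop)) 1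
        fun t ht => ?_
      rw [norm_pow, Real.norm_of_nonneg ht.1]
      exact pow_le_one₀ ht.1 ht.2.le
    have hi2 := integrable_profileDeriv hσ hv
    have h5 : profile (tilt ν) (1 / n) ≤
        ∫ t, (2 * t ^ (n - 1) + 3 * (1 / n * (1 - t) / ((1 - t) + 1 / n) ^ 2)) ∂tilt ν :=
      integral_mono_ae (integrable_profile hσ hv) ((hi1.const_mul 2).add (hi2.const_mul 3))
        (hσ.mono fun t ht => profile_integrand_le ht hn)
    rw [integral_add (hi1.const_mul 2) (hi2.const_mul 3), integral_const_mul,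
      integral_const_mul] at h5
    change _ ≤ 2 * ∫ t, t ^ (n - 1) ∂tilt ν + 3 * profileDeriv (tilt ν) (1 / n) at h5
    linarith
  have h6 := profile_le_mul hσ hv h1 h2
  have h7 := profileDeriv_le_mul hσ hv h1 (by norm_num) h2
  calc profile (tilt ν) u ≤ 4 * profile (tilt ν) (1 / n) := h6
    _ ≤ 4 * ((16 * L + 3) * (4 ^ 2 * profileDeriv (tilt ν) u)) := by
        gcongr
        exact hmain.trans (by gcongr)
    _ = _ := by ring

end Representation

/-! ### Upper bounds for ψ, ψ', ψ'' and the lower bound for Re ψ. -/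

section Symbol

/-- The distance of `θ ∈ [0, 2π]` to the endpoints. -/
noncomputable def arc (θ : ℝ) : ℝ := min θ (2 * Real.pi - θ)

theorem arc_pos {θ : ℝ} (hθ : θ ∈ Ioo 0 (2 * Real.pi)) : 0 < arc θ :=
  lt_min hθ.1 (sub_pos.2 hθ.2)

theorem mem_Ioo_of_arc_pos {θ : ℝ} (hθ : 0 < arc θ) : θ ∈ Ioo 0 (2 * Real.pi) :=
  ⟨(lt_min_iff.1 hθ).1, sub_pos.1 (lt_min_iff.1 hθ).2⟩

theorem arc_le_pi (θ : ℝ) : arc θ ≤ Real.pi := by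
  rcases le_total θ Real.pi with h | h
  · exact (min_le_left _ _).trans h
  · exact (min_le_right _ _).trans (by linarith)

theorem arc_le_four (θ : ℝ) : arc θ ≤ 4 := (arc_le_pi θ).trans Real.pi_le_four

theorem continuous_arc : Continuous arc := by unfold arc; fun_prop

theorem cos_arc (θ : ℝ) : Real.cos (arc θ) = Real.cos θ := by
  rcases min_choice θ (2 * Real.pi - θ) with h | h <;> rw [arc, h]
  rw [Real.cos_two_pi_sub]

theorem abs_sin_arc (θ : ℝ) : |Real.sin (arc θ)| = |Real.sin θ| := by
  rcases min_choice θ (2 * Real.pi - θ) with h | h <;> rw [arc, h]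
  rw [Real.sin_two_pi_sub, abs_neg]

theorem two_sub_two_cos_le (θ : ℝ) : 2 - 2 * Real.cos θ ≤ arc θ ^ 2 := by
  rw [← cos_arc]
  linarith [Real.one_sub_sq_div_two_le_cos (x := arc θ)]

theorem le_two_sub_two_cos {θ : ℝ} (hθ : θ ∈ Ioo 0 (2 * Real.pi)) :
    arc θ ^ 2 / 4 ≤ 2 - 2 * Real.cos θ := by
  have h1 := arc_pos hθ
  have h2 := Real.cos_le_one_sub_mul_cos_sq (x := arc θ) (by rw [abs_of_pos h1]; exact arc_le_pi θ)
  have h3 : 1 / 8 ≤ 2 / Real.pi ^ 2 := by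
    rw [div_le_div_iff₀ (by norm_num) (by positivity)]
    nlinarith [Real.pi_le_four, Real.pi_pos]
  rw [cos_arc] at h2
  nlinarith [mul_le_mul_of_nonneg_right h3 (sq_nonneg (arc θ))]

theorem abs_sin_le_arc {θ : ℝ} (hθ : θ ∈ Ioo 0 (2 * Real.pi)) : |Real.sin θ| ≤ arc θ := by
  rw [← abs_sin_arc]
  exact Real.abs_sin_le_abs.trans_eq (abs_of_pos (arc_pos hθ))

/-- The denominator `1 - t e^{iθ}`. -/
noncomputable def den (θ t : ℝ) : ℂ := 1 - t * Complex.exp (θ * Complex.I)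

theorem norm_exp_mul_I (θ : ℝ) : ‖Complex.exp (θ * Complex.I)‖ = 1 :=
  Complex.norm_exp_ofReal_mul_I θ

theorem den_re (θ t : ℝ) : (den θ t).re = 1 - t * Real.cos θ := by
  simp [den, Complex.exp_ofReal_mul_I_re]

theorem normSq_den (θ t : ℝ) :
    Complex.normSq (den θ t) = (1 - t) ^ 2 + t * (2 - 2 * Real.cos θ) := by
  have h1 : (den θ t).im = -(t * Real.sin θ) := by
    simp [den, Complex.exp_ofReal_mul_I_im]
  rw [Complex.normSq_apply, den_re, h1]
  linear_combination t ^ 2 * Real.sin_sq_add_cos_sq θ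

theorem normSq_den_le (θ : ℝ) {t : ℝ} (ht : t ∈ Ico (0 : ℝ) 1) (hθ : 0 ≤ arc θ) :
    Complex.normSq (den θ t) ≤ ((1 - t) + arc θ) ^ 2 := by
  rw [normSq_den]
  nlinarith [two_sub_two_cos_le θ, ht.1, ht.2, Real.cos_le_one θ,
    mul_nonneg (sub_nonneg.2 ht.2.le) hθ]

/-- For t ≤ 1/2 the norm is at least 1/2, while (1-t) + arc θ ≤ 5; this fixes the constant 10. For t
≥ 1/2 the squared norm is at least (1-t)² + arc² / 8. -/
theorem le_norm_den {θ t : ℝ} (hθ : θ ∈ Ioo 0 (2 * Real.pi)) (ht : t ∈ Ico (0 : ℝ) 1) :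
    ((1 - t) + arc θ) / 10 ≤ ‖den θ t‖ := by
  have h1 := arc_pos hθ
  have h2 := arc_le_four θ
  have h3 := le_two_sub_two_cos hθ
  have h4 := ht.1
  have h5 := ht.2
  refine le_of_sq_le_sq ?_ (norm_nonneg _)
  rw [← Complex.normSq_eq_norm_sq, normSq_den]
  rcases le_total t (1 / 2) with h | h
  · have h6 : ((1 - t) + arc θ) ^ 2 ≤ 5 ^ 2 := by gcongr; linarith
    nlinarith [mul_nonneg h4 (by nlinarith : 0 ≤ 2 - 2 * Real.cos θ)]
  · nlinarith [sq_nonneg ((1 - t) - arc θ)]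

theorem den_ne_zero {θ t : ℝ} (hθ : θ ∈ Ioo 0 (2 * Real.pi)) (ht : t ∈ Ico (0 : ℝ) 1) :
    den θ t ≠ 0 := by
  rw [← norm_pos_iff]
  have h1 := arc_pos hθ
  have h2 := ht.2
  exact lt_of_lt_of_le (by linarith) (le_norm_den hθ ht)

/-- Re(1/d) = Re d / |d|² with Re d ≥ 1 - t. Up to the factor arc θ, the lower bound is the
integrand of Q. -/
theorem re_inv_den_ge {θ t : ℝ} (hθ : θ ∈ Ioo 0 (2 * Real.pi)) (ht : t ∈ Ico (0 : ℝ) 1) :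
    (1 - t) / ((1 - t) + arc θ) ^ 2 ≤ ((den θ t)⁻¹).re := by
  have h1 := arc_pos hθ
  have h2 : 0 < 1 - t := sub_pos.2 ht.2
  rw [Complex.inv_re, den_re]
  have h3 := normSq_den_le θ ht h1.le
  have h4 : 0 < Complex.normSq (den θ t) := Complex.normSq_pos.2 (den_ne_zero hθ ht)
  have h5 : 1 - t ≤ 1 - t * Real.cos θ := by nlinarith [Real.cos_le_one θ, ht.1]
  gcongr
  linarith

/-- One factor is kept as the integrand of S; each of the others costs 1 / arc θ. The exponents 0+1,
1+1, 2+1 in `res0`, `res1`, `res2` match this form. -/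
theorem norm_inv_den_pow_le {θ t : ℝ} (hθ : θ ∈ Ioo 0 (2 * Real.pi)) (ht : t ∈ Ico (0 : ℝ) 1)
    (k : ℕ) : ‖((den θ t) ^ (k + 1))⁻¹‖ ≤
      10 ^ (k + 1) / arc θ ^ (k + 1) * (arc θ / ((1 - t) + arc θ)) := by
  have h1 := arc_pos hθ
  have h2 : 0 < 1 - t := sub_pos.2 ht.2
  have h3 := le_norm_den hθ ht
  rw [norm_inv, norm_pow]
  calc (‖den θ t‖ ^ (k + 1))⁻¹ ≤ ((((1 - t) + arc θ) / 10) ^ (k + 1))⁻¹ := by gcongr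
    _ = 10 ^ (k + 1) / (((1 - t) + arc θ) ^ k * ((1 - t) + arc θ)) := by
        rw [div_pow, inv_div, pow_succ ((1 - t) + arc θ)]
    _ ≤ 10 ^ (k + 1) / (arc θ ^ k * ((1 - t) + arc θ)) := by
        gcongr
        linarith
    _ = _ := by
        rw [pow_succ (arc θ)]
        field_simp

theorem hasDerivAt_den (θ t : ℝ) :
    HasDerivAt (fun θ => den θ t) (-(t * (Complex.exp (θ * Complex.I) * Complex.I))) θ := by
  have h1 : HasDerivAt (fun θ : ℝ => (θ : ℂ) * Complex.I) Complex.I θ := by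
    simpa using (Complex.ofRealCLM.hasDerivAt (x := θ)).mul_const Complex.I
  exact (h1.cexp.const_mul (t : ℂ)).const_sub 1

/-- The integrands of `∫ 1 / (1 - t e^{iθ}) dσ` and of its first two derivatives. -/
noncomputable def res0 (θ t : ℝ) : ℂ := (den θ t ^ (0 + 1))⁻¹

noncomputable def res1 (θ t : ℝ) : ℂ :=
  t * Complex.exp (θ * Complex.I) * Complex.I * (den θ t ^ (1 + 1))⁻¹

noncomputable def res2 (θ t : ℝ) : ℂ :=
  -(t * Complex.exp (θ * Complex.I)) * (den θ t ^ (1 + 1))⁻¹ +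
    -(2 * (t * Complex.exp (θ * Complex.I)) ^ 2) * (den θ t ^ (2 + 1))⁻¹

theorem hasDerivAt_res0 {θ t : ℝ} (hθ : θ ∈ Ioo 0 (2 * Real.pi)) (ht : t ∈ Ico (0 : ℝ) 1) :
    HasDerivAt (fun θ => res0 θ t) (res1 θ t) θ := by
  have h0 := den_ne_zero hθ ht
  have := ((hasDerivAt_den θ t).pow (0 + 1)).inv (pow_ne_zero _ h0)
  convert! this using 1
  simp [res1]
  field_simp

theorem hasDerivAt_res1 {θ t : ℝ} (hθ : θ ∈ Ioo 0 (2 * Real.pi)) (ht : t ∈ Ico (0 : ℝ) 1) :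
    HasDerivAt (fun θ => res1 θ t) (res2 θ t) θ := by
  have h0 := den_ne_zero hθ ht
  have h1 : HasDerivAt (fun θ : ℝ => (θ : ℂ) * Complex.I) Complex.I θ := by
    simpa using (Complex.ofRealCLM.hasDerivAt (x := θ)).mul_const Complex.I
  have h2 := ((h1.cexp.const_mul (t : ℂ)).mul_const Complex.I).mul
    (((hasDerivAt_den θ t).pow (1 + 1)).inv (pow_ne_zero _ h0))
  convert! h2 using 1
  simp only [res2, Pi.pow_apply, Pi.inv_apply]
  set z := Complex.exp (θ * Complex.I)
  set d := den θ t
  have hI : Complex.I ^ 2 = -1 := Complex.I_sq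
  field_simp
  simp only [hI]
  push_cast
  ring

theorem norm_mul_exp_le {t : ℝ} (ht : t ∈ Ico (0 : ℝ) 1) (θ : ℝ) :
    ‖(t : ℂ) * Complex.exp (θ * Complex.I)‖ ≤ 1 := by
  rw [norm_mul, norm_exp_mul_I, mul_one, Complex.norm_real, Real.norm_of_nonneg ht.1]
  exact ht.2.le

theorem norm_res0_le {θ t : ℝ} (hθ : θ ∈ Ioo 0 (2 * Real.pi)) (ht : t ∈ Ico (0 : ℝ) 1) :
    ‖res0 θ t‖ ≤ 10 / arc θ * (arc θ / ((1 - t) + arc θ)) := by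
  simpa [res0] using norm_inv_den_pow_le hθ ht 0

theorem norm_res1_le {θ t : ℝ} (hθ : θ ∈ Ioo 0 (2 * Real.pi)) (ht : t ∈ Ico (0 : ℝ) 1) :
    ‖res1 θ t‖ ≤ 100 / arc θ ^ 2 * (arc θ / ((1 - t) + arc θ)) := by
  rw [res1, norm_mul, norm_mul, Complex.norm_I, mul_one]
  refine (mul_le_of_le_one_left (norm_nonneg _) (norm_mul_exp_le ht θ)).trans ?_
  refine (norm_inv_den_pow_le hθ ht 1).trans_eq ?_
  norm_num

theorem norm_res2_le {θ t : ℝ} (hθ : θ ∈ Ioo 0 (2 * Real.pi)) (ht : t ∈ Ico (0 : ℝ) 1) :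
    ‖res2 θ t‖ ≤ 2400 / arc θ ^ 3 * (arc θ / ((1 - t) + arc θ)) := by
  have h1 := arc_pos hθ
  have h2 := norm_mul_exp_le ht θ
  have h3 := norm_inv_den_pow_le hθ ht 1
  have h4 := norm_inv_den_pow_le hθ ht 2
  have h5 := (profile_integrand_mem ht h1).1
  have h6 : ‖res2 θ t‖ ≤ ‖(den θ t ^ (1 + 1))⁻¹‖ + 2 * ‖(den θ t ^ (2 + 1))⁻¹‖ := by
    rw [res2]
    refine (norm_add_le _ _).trans (add_le_add ?_ ?_)
    · rw [norm_mul, norm_neg]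
      exact mul_le_of_le_one_left (norm_nonneg _) h2
    · rw [norm_mul, norm_neg, norm_mul, norm_pow, Complex.norm_ofNat, mul_assoc]
      gcongr
      exact mul_le_of_le_one_left (norm_nonneg _) (pow_le_one₀ (norm_nonneg _) h2)
  have h7 : 100 / arc θ ^ 2 ≤ 400 / arc θ ^ 3 := by
    rw [div_le_div_iff₀ (by positivity) (by positivity)]
    nlinarith [arc_le_four θ, pow_pos h1 2]
  norm_num at h3 h4
  calc ‖res2 θ t‖ ≤ _ := h6
    _ ≤ 100 / arc θ ^ 2 * (arc θ / ((1 - t) + arc θ)) +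
        2 * (1000 / arc θ ^ 3 * (arc θ / ((1 - t) + arc θ))) := by
        norm_num
        gcongr
    _ ≤ 400 / arc θ ^ 3 * (arc θ / ((1 - t) + arc θ)) +
        2 * (1000 / arc θ ^ 3 * (arc θ / ((1 - t) + arc θ))) := by gcongr
    _ = _ := by ring

theorem continuous_den (θ : ℝ) : Continuous (den θ) := by unfold den; fun_prop

theorem measurable_res0 (θ : ℝ) : Measurable (res0 θ) :=
  ((continuous_den θ).measurable.pow_const _).inv

theorem measurable_res1 (θ : ℝ) : Measurable (res1 θ) :=
  Measurable.mul (Continuous.measurable (by fun_prop)) ((continuous_den θ).measurable.pow_const _).inv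

theorem measurable_res2 (θ : ℝ) : Measurable (res2 θ) :=
  (Measurable.mul (Continuous.measurable (by fun_prop))
    ((continuous_den θ).measurable.pow_const _).inv).add
  (Measurable.mul (Continuous.measurable (by fun_prop))
    ((continuous_den θ).measurable.pow_const _).inv)

variable {σ : Measure ℝ}

theorem norm_integral_le_profile [IsFiniteMeasure σ] (hσ : ∀ᵐ t ∂σ, t ∈ Ico (0 : ℝ) 1) {θ : ℝ}
    (hθ : θ ∈ Ioo 0 (2 * Real.pi)) {f : ℝ → ℂ} {c : ℝ}
    (hf : ∀ t ∈ Ico (0 : ℝ) 1, ‖f t‖ ≤ c * (arc θ / ((1 - t) + arc θ))) :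
    ‖∫ t, f t ∂σ‖ ≤ c * profile σ (arc θ) := by
  rw [profile, ← integral_const_mul]
  exact norm_integral_le_of_norm_le ((integrable_profile hσ (arc_pos hθ)).const_mul c)
    (hσ.mono hf)

theorem integrable_of_le_profile [IsFiniteMeasure σ] (hσ : ∀ᵐ t ∂σ, t ∈ Ico (0 : ℝ) 1) {θ : ℝ}
    (hθ : θ ∈ Ioo 0 (2 * Real.pi)) {f : ℝ → ℂ} (hm : Measurable f) {c : ℝ}
    (hf : ∀ t ∈ Ico (0 : ℝ) 1, ‖f t‖ ≤ c * (arc θ / ((1 - t) + arc θ))) : Integrable f σ :=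
  ((integrable_profile hσ (arc_pos hθ)).const_mul c).mono' hm.aestronglyMeasurable (hσ.mono hf)

/-- On this neighbourhood the bounds on `res1` and `res2` become constants, integrable for the
finite measure σ, which permits differentiation under the integral. -/
theorem arc_half_mem_nhds {θ : ℝ} (hθ : θ ∈ Ioo 0 (2 * Real.pi)) :
    {x | arc θ / 2 < arc x} ∈ nhds θ :=
  (isOpen_lt continuous_const continuous_arc).mem_nhds (half_lt_self (arc_pos hθ))

theorem hasDerivAt_integral_res0 [IsFiniteMeasure σ] (hσ : ∀ᵐ t ∂σ, t ∈ Ico (0 : ℝ) 1) {θ : ℝ}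
    (hθ : θ ∈ Ioo 0 (2 * Real.pi)) :
    HasDerivAt (fun θ => ∫ t, res0 θ t ∂σ) (∫ t, res1 θ t ∂σ) θ := by
  have h0 := half_pos (arc_pos hθ)
  refine (hasDerivAt_integral_of_dominated_loc_of_deriv_le (arc_half_mem_nhds hθ)
    (bound := fun _ => 100 / (arc θ / 2) ^ 2)
    (.of_forall fun x => (measurable_res0 x).aestronglyMeasurable)
    (integrable_of_le_profile hσ hθ (measurable_res0 θ) fun t ht => norm_res0_le hθ ht)
    (measurable_res1 θ).aestronglyMeasurable ?_ (integrable_const _) ?_).2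
  · refine hσ.mono fun t ht x hx => ?_
    have hx' := mem_Ioo_of_arc_pos (h0.trans hx)
    refine (norm_res1_le hx' ht).trans ?_
    have h1 := profile_integrand_mem ht (arc_pos hx')
    rw [← mul_one (100 / (arc θ / 2) ^ 2)]
    have hx2 : arc θ / 2 ≤ arc x := le_of_lt hx
    exact mul_le_mul (by gcongr) h1.2 h1.1 (by positivity)
  · exact hσ.mono fun t ht x hx => hasDerivAt_res0 (mem_Ioo_of_arc_pos (h0.trans hx)) ht

theorem hasDerivAt_integral_res1 [IsFiniteMeasure σ] (hσ : ∀ᵐ t ∂σ, t ∈ Ico (0 : ℝ) 1) {θ : ℝ}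
    (hθ : θ ∈ Ioo 0 (2 * Real.pi)) :
    HasDerivAt (fun θ => ∫ t, res1 θ t ∂σ) (∫ t, res2 θ t ∂σ) θ := by
  have h0 := half_pos (arc_pos hθ)
  refine (hasDerivAt_integral_of_dominated_loc_of_deriv_le (arc_half_mem_nhds hθ)
    (bound := fun _ => 2400 / (arc θ / 2) ^ 3)
    (.of_forall fun x => (measurable_res1 x).aestronglyMeasurable)
    (integrable_of_le_profile hσ hθ (measurable_res1 θ) fun t ht => norm_res1_le hθ ht)
    (measurable_res2 θ).aestronglyMeasurable ?_ (integrable_const _) ?_).2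
  · refine hσ.mono fun t ht x hx => ?_
    have hx' := mem_Ioo_of_arc_pos (h0.trans hx)
    refine (norm_res2_le hx' ht).trans ?_
    have h1 := profile_integrand_mem ht (arc_pos hx')
    rw [← mul_one (2400 / (arc θ / 2) ^ 3)]
    have hx2 : arc θ / 2 ≤ arc x := le_of_lt hx
    exact mul_le_mul (by gcongr) h1.2 h1.1 (by positivity)
  · exact hσ.mono fun t ht x hx => hasDerivAt_res1 (mem_Ioo_of_arc_pos (h0.trans hx)) ht

/-- The function `|1 - e^{iθ}|² ∫ 1 / (1 - t e^{iθ}) dσ(t)` and its first two derivatives. -/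
noncomputable def symb (σ : Measure ℝ) (θ : ℝ) : ℂ :=
  ((2 - 2 * Real.cos θ : ℝ) : ℂ) * ∫ t, res0 θ t ∂σ

noncomputable def symb1 (σ : Measure ℝ) (θ : ℝ) : ℂ :=
  ((2 * Real.sin θ : ℝ) : ℂ) * ∫ t, res0 θ t ∂σ + ((2 - 2 * Real.cos θ : ℝ) : ℂ) * ∫ t, res1 θ t ∂σ

noncomputable def symb2 (σ : Measure ℝ) (θ : ℝ) : ℂ :=
  (((2 * Real.cos θ : ℝ) : ℂ) * ∫ t, res0 θ t ∂σ + ((2 * Real.sin θ : ℝ) : ℂ) * ∫ t, res1 θ t ∂σ) +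
  (((2 * Real.sin θ : ℝ) : ℂ) * ∫ t, res1 θ t ∂σ +
    ((2 - 2 * Real.cos θ : ℝ) : ℂ) * ∫ t, res2 θ t ∂σ)

theorem hasDerivAt_two_sub_two_cos (θ : ℝ) :
    HasDerivAt (fun θ => ((2 - 2 * Real.cos θ : ℝ) : ℂ)) ((2 * Real.sin θ : ℝ) : ℂ) θ := by
  have := ((Real.hasDerivAt_cos θ).const_mul 2).const_sub 2
  convert! this.ofReal_comp using 1
  simp

theorem hasDerivAt_two_sin (θ : ℝ) :
    HasDerivAt (fun θ => ((2 * Real.sin θ : ℝ) : ℂ)) ((2 * Real.cos θ : ℝ) : ℂ) θ :=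
  ((Real.hasDerivAt_sin θ).const_mul 2).ofReal_comp

theorem hasDerivAt_symb [IsFiniteMeasure σ] (hσ : ∀ᵐ t ∂σ, t ∈ Ico (0 : ℝ) 1) {θ : ℝ}
    (hθ : θ ∈ Ioo 0 (2 * Real.pi)) : HasDerivAt (symb σ) (symb1 σ θ) θ :=
  (hasDerivAt_two_sub_two_cos θ).mul (hasDerivAt_integral_res0 hσ hθ)

theorem hasDerivAt_symb1 [IsFiniteMeasure σ] (hσ : ∀ᵐ t ∂σ, t ∈ Ico (0 : ℝ) 1) {θ : ℝ}
    (hθ : θ ∈ Ioo 0 (2 * Real.pi)) : HasDerivAt (symb1 σ) (symb2 σ θ) θ :=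
  ((hasDerivAt_two_sin θ).mul (hasDerivAt_integral_res0 hσ hθ)).add
    ((hasDerivAt_two_sub_two_cos θ).mul (hasDerivAt_integral_res1 hσ hθ))

theorem norm_two_sub_two_cos_le {θ : ℝ} : ‖((2 - 2 * Real.cos θ : ℝ) : ℂ)‖ ≤ arc θ ^ 2 := by
  rw [Complex.norm_real, Real.norm_of_nonneg (by linarith [Real.cos_le_one θ])]
  exact two_sub_two_cos_le θ

theorem norm_two_sin_le {θ : ℝ} (hθ : θ ∈ Ioo 0 (2 * Real.pi)) :
    ‖((2 * Real.sin θ : ℝ) : ℂ)‖ ≤ 2 * arc θ := by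
  rw [Complex.norm_real, norm_mul, Real.norm_eq_abs, Real.norm_eq_abs, abs_two]
  linarith [abs_sin_le_arc hθ]

theorem norm_two_cos_le {θ : ℝ} : ‖((2 * Real.cos θ : ℝ) : ℂ)‖ ≤ 2 := by
  rw [Complex.norm_real, norm_mul, Real.norm_eq_abs, Real.norm_eq_abs, abs_two]
  linarith [Real.abs_cos_le_one θ]

/-- The computations give 10, 120 and 2820 for ψ, ψ' and ψ''; the common value 3000 supplies the
single constant K of `SymbolBound`. -/
theorem norm_symb_le [IsFiniteMeasure σ] (hσ : ∀ᵐ t ∂σ, t ∈ Ico (0 : ℝ) 1) {θ : ℝ}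
    (hθ : θ ∈ Ioo 0 (2 * Real.pi)) : ‖symb σ θ‖ ≤ 3000 * (arc θ * profile σ (arc θ)) := by
  have h := arc_pos hθ
  have h0 := norm_integral_le_profile hσ hθ fun t ht => norm_res0_le hθ ht
  have hS := profile_nonneg hσ h
  rw [symb, norm_mul]
  calc _ ≤ arc θ ^ 2 * (10 / arc θ * profile σ (arc θ)) :=
        mul_le_mul norm_two_sub_two_cos_le h0 (norm_nonneg _) (by positivity)
    _ = 10 * (arc θ * profile σ (arc θ)) := by field_simp
    _ ≤ _ := by gcongr; norm_num

theorem norm_symb1_le [IsFiniteMeasure σ] (hσ : ∀ᵐ t ∂σ, t ∈ Ico (0 : ℝ) 1) {θ : ℝ}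
    (hθ : θ ∈ Ioo 0 (2 * Real.pi)) : ‖symb1 σ θ‖ ≤ 3000 * profile σ (arc θ) := by
  have h := arc_pos hθ
  have h0 := norm_integral_le_profile hσ hθ fun t ht => norm_res0_le hθ ht
  have h1 := norm_integral_le_profile hσ hθ fun t ht => norm_res1_le hθ ht
  have hS := profile_nonneg hσ h
  rw [symb1]
  calc _ ≤ 2 * arc θ * (10 / arc θ * profile σ (arc θ)) +
        arc θ ^ 2 * (100 / arc θ ^ 2 * profile σ (arc θ)) := by
        refine (norm_add_le _ _).trans ?_
        rw [norm_mul, norm_mul]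
        exact add_le_add (mul_le_mul (norm_two_sin_le hθ) h0 (norm_nonneg _) (by positivity))
          (mul_le_mul norm_two_sub_two_cos_le h1 (norm_nonneg _) (by positivity))
    _ = 120 * profile σ (arc θ) := by field_simp; ring
    _ ≤ _ := by gcongr; norm_num

theorem norm_symb2_le [IsFiniteMeasure σ] (hσ : ∀ᵐ t ∂σ, t ∈ Ico (0 : ℝ) 1) {θ : ℝ}
    (hθ : θ ∈ Ioo 0 (2 * Real.pi)) : ‖symb2 σ θ‖ ≤ 3000 * (profile σ (arc θ) / arc θ) := by
  have h := arc_pos hθ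
  have h0 := norm_integral_le_profile hσ hθ fun t ht => norm_res0_le hθ ht
  have h1 := norm_integral_le_profile hσ hθ fun t ht => norm_res1_le hθ ht
  have h2 := norm_integral_le_profile hσ hθ fun t ht => norm_res2_le hθ ht
  have hS := profile_nonneg hσ h
  rw [symb2]
  calc _ ≤ (2 * (10 / arc θ * profile σ (arc θ)) +
        2 * arc θ * (100 / arc θ ^ 2 * profile σ (arc θ))) +
        (2 * arc θ * (100 / arc θ ^ 2 * profile σ (arc θ)) +
        arc θ ^ 2 * (2400 / arc θ ^ 3 * profile σ (arc θ))) := by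
        refine (norm_add_le _ _).trans (add_le_add ((norm_add_le _ _).trans ?_)
          ((norm_add_le _ _).trans ?_))
        · rw [norm_mul, norm_mul]
          exact add_le_add (mul_le_mul norm_two_cos_le h0 (norm_nonneg _) (by positivity))
            (mul_le_mul (norm_two_sin_le hθ) h1 (norm_nonneg _) (by positivity))
        · rw [norm_mul, norm_mul]
          exact add_le_add (mul_le_mul (norm_two_sin_le hθ) h1 (norm_nonneg _) (by positivity))
            (mul_le_mul norm_two_sub_two_cos_le h2 (norm_nonneg _) (by positivity))
    _ = 2820 * (profile σ (arc θ) / arc θ) := by field_simp; ring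
    _ ≤ _ := by gcongr; norm_num

theorem re_symb_ge [IsFiniteMeasure σ] (hσ : ∀ᵐ t ∂σ, t ∈ Ico (0 : ℝ) 1) {θ : ℝ}
    (hθ : θ ∈ Ioo 0 (2 * Real.pi)) : arc θ * profileDeriv σ (arc θ) / 4 ≤ (symb σ θ).re := by
  have h := arc_pos hθ
  have hi := integrable_of_le_profile hσ hθ (measurable_res0 θ) fun t ht => norm_res0_le hθ ht
  have h1 : profileDeriv σ (arc θ) / arc θ ≤ (∫ t, res0 θ t ∂σ).re := by
    have e : (∫ t, res0 θ t ∂σ).re = ∫ t, (res0 θ t).re ∂σ := (integral_re hi).symm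
    rw [e, profileDeriv, ← integral_div]
    refine integral_mono_ae ((integrable_profileDeriv hσ h).div_const _) hi.re
      (hσ.mono fun t ht => ?_)
    have := re_inv_den_ge hθ ht
    show arc θ * (1 - t) / ((1 - t) + arc θ) ^ 2 / arc θ ≤ (res0 θ t).re
    rw [div_right_comm, mul_div_cancel_left₀ _ h.ne']
    simpa [res0] using this
  have hQ := profileDeriv_nonneg hσ h
  rw [symb, Complex.re_ofReal_mul]
  calc arc θ * profileDeriv σ (arc θ) / 4 = arc θ ^ 2 / 4 * (profileDeriv σ (arc θ) / arc θ) := by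
        field_simp
    _ ≤ _ := mul_le_mul (le_two_sub_two_cos hθ) h1 (by positivity)
        (by linarith [Real.cos_le_one θ])

end Symbol

/-! ### The Fourier transform of μ as 1 - ψ, and its decay. -/

section Characteristic

variable {μ : Measure ℤ} {ν : Measure ℝ}

theorem mass_nonneg (μ : Measure ℤ) (k : ℤ) : 0 ≤ mass μ k := measureReal_nonneg

theorem hasSum_mass (μ : Measure ℤ) [IsProbabilityMeasure μ] : HasSum (mass μ) 1 := by
  have h1 : ∑' k : ℤ, μ {k} = 1 := by
    rw [← measure_univ (μ := μ), ← lintegral_one, lintegral_countable']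
    simp
  have h2 := ENNReal.hasSum_toReal (f := fun k : ℤ => μ {k}) (by rw [h1]; exact ENNReal.one_ne_top)
  rw [← ENNReal.tsum_toReal_eq (fun k => measure_ne_top _ _), h1] at h2
  exact h2

theorem IsCCM.mass_eq_zero (h : IsCCM μ ν) {k : ℤ} (hk : k < -1) : mass μ k = 0 := by
  have : μ {k} = 0 := measure_mono_null (by simpa using hk) h.support
  simp [mass, measureReal_def, this]

theorem norm_mul_exp_lt_one {t : ℝ} (ht : t ∈ Ico (0 : ℝ) 1) (θ : ℝ) :
    ‖(t : ℂ) * Complex.exp (θ * Complex.I)‖ < 1 := by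
  rw [norm_mul, norm_exp_mul_I, mul_one, Complex.norm_real, Real.norm_of_nonneg ht.1]
  exact ht.2

theorem IsCCM.hasSum_nat_mass (h : IsCCM μ ν) [IsProbabilityMeasure μ] (θ : ℝ) :
    HasSum (fun n : ℕ => (mass μ n : ℂ) * Complex.exp ((n : ℤ) * θ * Complex.I))
      (∫ t, (den θ t)⁻¹ ∂ν) := by
  have hsum : Summable fun n : ℕ => mass μ n :=
    (hasSum_mass μ).summable.comp_injective Nat.cast_injective
  have hF : ∀ (n : ℕ) (t : ℝ), ((t : ℂ) * Complex.exp (θ * Complex.I)) ^ n =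
      ((t ^ n : ℝ) : ℂ) * Complex.exp ((n : ℤ) * θ * Complex.I) := by
    intro n t
    rw [mul_pow, ← Complex.exp_nat_mul, Complex.ofReal_pow]
    congr 2
    push_cast
    ring
  have hint : ∀ n : ℕ, Integrable (fun t : ℝ => ((t : ℂ) * Complex.exp (θ * Complex.I)) ^ n) ν := by
    intro n
    simp_rw [hF]
    exact (h.integrable_pow n).ofReal.mul_const _
  have h1 := hasSum_integral_of_summable_integral_norm hint (by
    refine hsum.congr fun n => ?_
    rw [h.nat_mass]
    refine integral_congr_ae (h.ae_mem.mono fun t ht => ?_)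
    show t ^ n = ‖((t : ℂ) * Complex.exp (θ * Complex.I)) ^ n‖
    rw [norm_pow, norm_mul, norm_exp_mul_I, mul_one, Complex.norm_real, Real.norm_of_nonneg ht.1])
  have h2 : ∫ t, ∑' n : ℕ, ((t : ℂ) * Complex.exp (θ * Complex.I)) ^ n ∂ν =
      ∫ t, (den θ t)⁻¹ ∂ν := by
    refine integral_congr_ae (h.ae_mem.mono fun t ht => ?_)
    exact tsum_geometric_of_norm_lt_one (norm_mul_exp_lt_one ht θ)
  rw [h2] at h1
  refine h1.congr_fun fun n => ?_
  simp_rw [hF]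
  rw [integral_mul_const, h.nat_mass, integral_complex_ofReal]

/-- With z = e^{iθ}, the identity t/((1-t)² z) + 1/(1-tz) + (2-z-1/z) t/((1-t)²(1-tz)) = 1/(1-t)²
holds for each t. Integrated against ν, its left side is the Fourier transform of μ plus ψ, because
μ(-1) = ∫ t/(1-t)² dν, and its right side is 1 by the normalization. -/
theorem IsCCM.ft_mass (h : IsCCM μ ν) [IsProbabilityMeasure μ] {θ : ℝ}
    (hθ : θ ∈ Ioo 0 (2 * Real.pi)) : ft (mass μ) θ = 1 - symb (tilt ν) θ := by
  have hfin := h.isFiniteMeasure_tilt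
  have hneg : HasSum (fun n : ℕ => (mass μ (-((n : ℤ) + 1)) : ℂ) *
      Complex.exp ((-((n : ℤ) + 1) : ℤ) * θ * Complex.I))
      (mass μ (-1) * (Complex.exp (θ * Complex.I))⁻¹) := by
    have := hasSum_single (f := fun n : ℕ => (mass μ (-((n : ℤ) + 1)) : ℂ) *
      Complex.exp ((-((n : ℤ) + 1) : ℤ) * θ * Complex.I)) 0 (by
        intro n hn
        rw [h.mass_eq_zero (by lia)]
        simp)
    convert! this using 1
    simp [← Complex.exp_neg]
  have h1 := HasSum.of_nat_of_neg_add_one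
    (f := fun k : ℤ => (mass μ k : ℂ) * Complex.exp (k * θ * Complex.I)) (h.hasSum_nat_mass θ) hneg
  have hz : Complex.exp (θ * Complex.I) ≠ 0 := Complex.exp_ne_zero _
  have hi0 : Integrable (fun t => 1 / (1 - t)) ν := by
    refine h.integrable_of_le (Measurable.aestronglyMeasurable (by fun_prop)) 1 fun t ht => ?_
    have h1 : 0 < 1 - t := sub_pos.2 ht.2
    rw [one_mul, Real.norm_of_nonneg (by positivity)]
    refine one_div_le_one_div_of_le (by positivity) ?_
    nlinarith [ht.1]
  have hi1 : Integrable (fun t => (den θ t)⁻¹) ν := by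
    refine h.integrable_of_le ((continuous_den θ).measurable.inv.aestronglyMeasurable)
      (10 / arc θ) fun t ht => ?_
    have h2 := norm_inv_den_pow_le hθ ht 0
    have h3 := profile_integrand_mem ht (arc_pos hθ)
    have h4 : 0 < 1 - t := sub_pos.2 ht.2
    have h5 := arc_pos hθ
    simp only [zero_add, pow_one] at h2
    refine h2.trans (mul_le_mul_of_nonneg_left ?_ (by positivity))
    refine h3.2.trans ((one_le_div (by positivity)).2 (pow_le_one₀ h4.le (by linarith [ht.1])))
  have hi2 : Integrable (fun t => t / (1 - t) ^ 2) ν := by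
    refine h.integrable_of_le (Measurable.aestronglyMeasurable (by fun_prop)) 1 fun t ht => ?_
    have h1 : 0 < 1 - t := sub_pos.2 ht.2
    have h2 := ht.1
    have h3 := ht.2.le
    rw [one_mul, Real.norm_of_nonneg (by positivity)]
    gcongr
  have hi3 : Integrable (fun t => (t / (1 - t) ^ 2) • res0 θ t) ν := by
    refine h.integrable_of_le (((show Measurable fun t : ℝ => t / (1 - t) ^ 2 by fun_prop).smul
      (measurable_res0 θ)).aestronglyMeasurable)
      (10 / arc θ) fun t ht => ?_
    have h2 := norm_res0_le hθ ht
    have h3 := profile_integrand_mem ht (arc_pos hθ)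
    have h4 : 0 < 1 - t := sub_pos.2 ht.2
    have h5 := arc_pos hθ
    have h6 := ht.1
    have h7 := ht.2.le
    rw [norm_smul, Real.norm_of_nonneg (by positivity), mul_comm]
    refine mul_le_mul (h2.trans (mul_le_of_le_one_right (by positivity) h3.2)) (by gcongr)
      (by positivity) (by positivity)
  have hone : ∫ t, 1 / (1 - t) ^ 2 ∂ν = 1 := by
    rw [integral_eq_lintegral_of_nonneg_ae (.of_forall fun t => by positivity)
      (Measurable.aestronglyMeasurable (by fun_prop)), h.lintegral_inv_sq, ENNReal.toReal_one]
  have hneg1 : mass μ (-1) = ∫ t, t / (1 - t) ^ 2 ∂ν := by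
    have e := integral_sub h.integrable_inv_sq hi0
    rw [hone] at e
    rw [h.neg_one_mass, ← e]
    refine integral_congr_ae (h.ae_mem.mono fun t ht => ?_)
    have h1 : 1 - t ≠ 0 := (sub_pos.2 ht.2).ne'
    show 1 / (1 - t) ^ 2 - 1 / (1 - t) = t / (1 - t) ^ 2
    field_simp
    ring
  have key : (mass μ (-1) : ℂ) * (Complex.exp (θ * Complex.I))⁻¹ + ∫ t, (den θ t)⁻¹ ∂ν +
      symb (tilt ν) θ = 1 := by
    have hi4 : Integrable (fun t : ℝ => ((t / (1 - t) ^ 2 : ℝ) : ℂ) *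
      (Complex.exp (θ * Complex.I))⁻¹) ν := hi2.ofReal.mul_const _
    have hi5 : Integrable (fun t : ℝ => ((t / (1 - t) ^ 2 : ℝ) : ℂ) *
      (Complex.exp (θ * Complex.I))⁻¹ + (den θ t)⁻¹) ν := hi4.add hi1
    rw [hneg1, symb, h.integral_tilt, ← integral_complex_ofReal, ← integral_mul_const,
      ← integral_const_mul, ← integral_add hi4 hi1,
      ← integral_add hi5 (hi3.const_mul _)]
    have : (1 : ℂ) = ((∫ t, 1 / (1 - t) ^ 2 ∂ν : ℝ) : ℂ) := by rw [hone]; simp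
    rw [this, ← integral_complex_ofReal]
    refine integral_congr_ae (h.ae_mem.mono fun t ht => ?_)
    have h1 : ((1 - t : ℝ) : ℂ) ≠ 0 := by exact_mod_cast (sub_pos.2 ht.2).ne'
    have h2 := den_ne_zero hθ ht
    have hcos : ((2 - 2 * Real.cos θ : ℝ) : ℂ) =
        2 - Complex.exp (θ * Complex.I) - (Complex.exp (θ * Complex.I))⁻¹ := by
      rw [← Complex.exp_neg]
      push_cast
      rw [Complex.cos, neg_mul]
      ring
    simp only [res0, zero_add, pow_one, Complex.real_smul]
    rw [hcos]
    push_cast at h1 ⊢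
    simp only [den] at h2 ⊢
    set z := Complex.exp (θ * Complex.I)
    field_simp
    ring
  rw [ft, h1.tsum_eq, ← key]
  ring

/-- Removing the atom at 0 leaves a positive measure of total mass 1 - μ(0). -/
theorem norm_ft_sub_le (μ : Measure ℤ) [IsProbabilityMeasure μ] (θ : ℝ) :
    ‖ft (mass μ) θ - mass μ 0‖ ≤ 1 - mass μ 0 := by
  have hs := hasSum_mass μ
  have hd : HasSum (fun k => mass μ 0 * delta k) (mass μ 0) := by
    have := (hasSum_pi_single (0 : ℤ) (1 : ℝ)).mul_left (mass μ 0)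
    rwa [mul_one] at this
  have h1 : ft (fun k => mass μ 0 * delta k) θ = mass μ 0 := by
    have : ft (fun k => mass μ 0 * delta k) θ = mass μ 0 * ft delta θ := by
      rw [ft, ft, ← tsum_mul_left]
      congr 1 with k
      push_cast
      ring
    rw [this, ft_delta, mul_one]
  have h2 := norm_ft_le (hs.summable.sub hd.summable) θ
  have h3 : ft (fun k => mass μ k - mass μ 0 * delta k) θ = ft (mass μ) θ - mass μ 0 := by
    have := ft_sub hs.summable hd.summable θ
    rw [h1] at this
    exact this
  rw [h3] at h2
  refine h2.trans_eq ?_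
  rw [← (hs.sub hd).tsum_eq]
  congr 1 with k
  refine abs_of_nonneg ?_
  by_cases hk : k = 0
  · simp [hk, delta]
  · simp [hk, delta, mass_nonneg]

/-- Put a = μ(0). Squaring |1 - w - a| ≤ 1 - a gives |w|² ≤ 2(1-a) Re w, hence |1-w|² ≤ 1 - 2a Re w
≤ exp(-2a Re w). -/
theorem IsCCM.norm_one_sub_symb_le (h : IsCCM μ ν) [IsProbabilityMeasure μ] {θ : ℝ}
    (hθ : θ ∈ Ioo 0 (2 * Real.pi)) :
    ‖1 - symb (tilt ν) θ‖ ≤ Real.exp (-(mass μ 0 * (symb (tilt ν) θ).re)) := by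
  have h1 := norm_ft_sub_le μ θ
  have ha : 0 ≤ 1 - mass μ 0 := (norm_nonneg _).trans h1
  rw [h.ft_mass hθ] at h1
  set w := symb (tilt ν) θ
  have h2 := pow_le_pow_left₀ (norm_nonneg _) h1 2
  rw [← Complex.normSq_eq_norm_sq, Complex.normSq_apply] at h2
  simp at h2
  have h3 : ‖1 - w‖ ^ 2 ≤ Real.exp (-(mass μ 0 * w.re)) ^ 2 := by
    rw [← Real.exp_nat_mul, ← Complex.normSq_eq_norm_sq, Complex.normSq_apply]
    refine le_trans ?_ (Real.add_one_le_exp _)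
    simp
    nlinarith
  exact le_of_sq_le_sq h3 (Real.exp_pos _).le

end Characteristic

/-! ### Pointwise bounds for (nψ)^m (1-ψ)^n and its second derivative. -/

section PowerBounds

theorem exists_one_add_pow_mul_exp_le (k : ℕ) {c : ℝ} (hc : 0 < c) :
    ∃ C : ℝ, 0 < C ∧ ∀ X : ℝ, 0 ≤ X → (1 + X) ^ k * Real.exp (-(c * X)) ≤ C := by
  refine ⟨Real.exp c * (k.factorial / c ^ k), by positivity, fun X hX => ?_⟩
  have h1 := Real.pow_div_factorial_le_exp (c * (1 + X)) (by positivity) k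
  rw [div_le_iff₀ (by positivity), mul_pow] at h1
  have h2 : Real.exp (c * (1 + X)) * Real.exp (-(c * X)) = Real.exp c := by
    rw [← Real.exp_add]
    congr 1
    ring
  calc (1 + X) ^ k * Real.exp (-(c * X))
      = (c ^ k * (1 + X) ^ k) * Real.exp (-(c * X)) / c ^ k := by field_simp
    _ ≤ (Real.exp (c * (1 + X)) * k.factorial) * Real.exp (-(c * X)) / c ^ k := by gcongr
    _ = (Real.exp (c * (1 + X)) * Real.exp (-(c * X))) * (k.factorial / c ^ k) := by ring
    _ = _ := by rw [h2]

/-- The first two derivatives of `(n ψ) ^ m (1 - ψ) ^ n`, in terms of those of `ψ`. -/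
noncomputable def powMul (n m : ℕ) (w : ℂ) : ℂ := (n * w) ^ m * (1 - w) ^ n

/-- The truncated exponents are harmless: whenever m - 1 or n - 1 is truncated, the coefficient in
front vanishes. The same holds in `powMul2`. -/
noncomputable def powMul1 (n m : ℕ) (w w1 : ℂ) : ℂ :=
  m * (n * w) ^ (m - 1) * (n * w1) * (1 - w) ^ n + (n * w) ^ m * (n * (1 - w) ^ (n - 1) * -w1)

noncomputable def powMul2 (n m : ℕ) (w w1 w2 : ℂ) : ℂ :=
  ((m * (((m - 1 : ℕ) * (n * w) ^ (m - 1 - 1) * (n * w1))) * (n * w1) +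
      m * (n * w) ^ (m - 1) * (n * w2)) * (1 - w) ^ n +
    m * (n * w) ^ (m - 1) * (n * w1) * (n * (1 - w) ^ (n - 1) * -w1)) +
  (m * (n * w) ^ (m - 1) * (n * w1) * (n * (1 - w) ^ (n - 1) * -w1) +
    (n * w) ^ m * (n * ((n - 1 : ℕ) * (1 - w) ^ (n - 1 - 1) * -w1) * -w1 +
      n * (1 - w) ^ (n - 1) * -w2))

theorem hasDerivAt_powMul (n m : ℕ) {w : ℝ → ℂ} {w1 : ℂ} {θ : ℝ} (h : HasDerivAt w w1 θ) :
    HasDerivAt (fun θ => powMul n m (w θ)) (powMul1 n m (w θ) w1) θ :=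
  ((h.const_mul (n : ℂ)).pow m).mul ((h.const_sub 1).pow n)

theorem hasDerivAt_powMul1 (n m : ℕ) {w w1 : ℝ → ℂ} {w2 : ℂ} {θ : ℝ} (h : HasDerivAt w (w1 θ) θ)
    (h1 : HasDerivAt w1 w2 θ) :
    HasDerivAt (fun θ => powMul1 n m (w θ) (w1 θ)) (powMul2 n m (w θ) (w1 θ) w2) θ :=
  (((((h.const_mul (n : ℂ)).pow (m - 1)).const_mul (m : ℂ)).mul (h1.const_mul (n : ℂ))).mul
    ((h.const_sub 1).pow n)).add
  (((h.const_mul (n : ℂ)).pow m).mul ((((h.const_sub 1).pow (n - 1)).const_mul (n : ℂ)).mul h1.neg))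

/-- The size of `ψ`, its derivatives, and `1 - ψ` at a point at distance `v` from the singularity. -/
structure SymbolBound (K c B v R : ℝ) (w w1 w2 : ℂ) : Prop where
  one_le : 1 ≤ K
  c_pos : 0 < c
  v_pos : 0 < v
  R_nonneg : 0 ≤ R
  R_le : R ≤ B
  norm_le : ‖w‖ ≤ K * R
  norm1_le : ‖w1‖ ≤ K * R / v
  norm2_le : ‖w2‖ ≤ K * R / v ^ 2
  decay : ‖1 - w‖ ≤ Real.exp (-(c * R))

variable {K c B v R : ℝ} {w w1 w2 : ℂ}

/-- Losing at most two factors of 1 - w costs at most exp(2cB), because R ≤ B. -/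
theorem SymbolBound.norm_pow_sub_le (h : SymbolBound K c B v R w w1 w2) (n j : ℕ) (hj : j ≤ 2) :
    ‖(1 - w) ^ (n - j)‖ ≤ Real.exp (2 * c * B) * Real.exp (-(c * (n * R))) := by
  rw [norm_pow, ← Real.exp_add]
  refine (pow_le_pow_left₀ (norm_nonneg _) h.decay _).trans ?_
  rw [← Real.exp_nat_mul, Real.exp_le_exp]
  have h1 : (n : ℝ) ≤ (n - j : ℕ) + 2 := by
    have : n ≤ (n - j) + 2 := by lia
    exact_mod_cast this
  have h2 := mul_nonneg h.c_pos.le h.R_nonneg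
  have h3 := mul_le_mul_of_nonneg_left h.R_le h.c_pos.le
  nlinarith [mul_le_mul_of_nonneg_right h1 h2]

theorem SymbolBound.norm_powMul_aux (h : SymbolBound K c B v R w w1 w2) (n m j : ℕ) :
    ‖((n : ℂ) * w) ^ (m - j)‖ ≤ (K * (1 + n * R)) ^ m := by
  have h0 := h.one_le
  have h1 := h.R_nonneg
  have h2 : 1 ≤ K * (1 + n * R) :=
    one_le_mul_of_one_le_of_one_le h0 (le_add_of_nonneg_right (by positivity))
  rw [norm_pow, norm_mul, Complex.norm_natCast]
  refine le_trans ?_ (pow_le_pow_right₀ h2 (Nat.sub_le m j))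
  refine pow_le_pow_left₀ (by positivity) ?_ _
  calc (n : ℝ) * ‖w‖ ≤ n * (K * R) := by gcongr; exact h.norm_le
    _ ≤ _ := by nlinarith

theorem SymbolBound.norm_powMul_le (h : SymbolBound K c B v R w w1 w2) (n m : ℕ) :
    ‖powMul n m w‖ ≤
      Real.exp (2 * c * B) * ((K * (1 + n * R)) ^ m * Real.exp (-(c * (n * R)))) := by
  have h1 := h.norm_powMul_aux n m 0
  have h2 := h.norm_pow_sub_le n 0 (by lia)
  have h3 := h.one_le
  have h4 := h.R_nonneg
  rw [powMul, norm_mul]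
  exact (mul_le_mul h1 h2 (norm_nonneg _) (by positivity)).trans_eq (by ring)

/-- Every term contains nψ'' or two factors nψ', so one factor nR/v² can be kept outside the powers
of 1 + nR. Its smallness for small R is what makes the bound integrable at the singularity. -/
theorem SymbolBound.norm_powMul2_le (h : SymbolBound K c B v R w w1 w2) (n m : ℕ) :
    ‖powMul2 n m w w1 w2‖ ≤ ((m + 1) * (m + 2)) * (Real.exp (2 * c * B) *
      ((K * (1 + n * R)) ^ (m + 1) * Real.exp (-(c * (n * R))))) * (K * (n * R) / v ^ 2) := by
  have a0 := h.norm_powMul_aux n m 0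
  have a1 := h.norm_powMul_aux n m 1
  have a2 := h.norm_powMul_aux n m 2
  have b0 := h.norm_pow_sub_le n 0 (by lia)
  have b1 := h.norm_pow_sub_le n 1 (by lia)
  have b2 := h.norm_pow_sub_le n 2 (by lia)
  have hK := h.one_le
  have hR := h.R_nonneg
  have hv := h.v_pos
  set Z := K * (1 + n * R) with hZdef
  have hxZ : K * (n * R) ≤ Z := by rw [hZdef]; nlinarith
  have hZ1 : 1 ≤ Z :=
    one_le_mul_of_one_le_of_one_le hK (le_add_of_nonneg_right (by positivity))
  have hZ : 0 ≤ Z := by positivity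
  set E := Real.exp (2 * c * B) * Real.exp (-(c * (n * R))) with hE
  have hE0 : 0 ≤ E := by positivity
  set x := K * (n * R) with hxdef
  have hx0 : 0 ≤ x := by positivity
  have hx1 : (n : ℝ) * ‖w1‖ ≤ x / v := by
    calc (n : ℝ) * ‖w1‖ ≤ n * (K * R / v) := by gcongr; exact h.norm1_le
      _ = _ := by rw [hxdef]; ring
  have hx2 : (n : ℝ) * ‖w2‖ ≤ x / v ^ 2 := by
    calc (n : ℝ) * ‖w2‖ ≤ n * (K * R / v ^ 2) := by gcongr; exact h.norm2_le
      _ = _ := by rw [hxdef]; ring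
  have hm : ((m - 1 : ℕ) : ℝ) ≤ m := by exact_mod_cast Nat.sub_le m 1
  have hn : ((n - 1 : ℕ) : ℝ) ≤ n := by exact_mod_cast Nat.sub_le n 1
  rw [Nat.sub_zero] at a0 b0
  have t1 : ‖(m * (((m - 1 : ℕ) * (n * w) ^ (m - 1 - 1) * (n * w1))) * (n * w1) +
      m * (n * w) ^ (m - 1) * (n * w2)) * (1 - w) ^ n‖ ≤
      (m * (m * Z ^ m * (x / v)) * (x / v) + m * Z ^ m * (x / v ^ 2)) * E := by
    rw [Nat.sub_sub, norm_mul]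
    refine mul_le_mul ((norm_add_le _ _).trans (add_le_add ?_ ?_)) b0 (norm_nonneg _)
      (by positivity)
    · simp only [norm_mul, Complex.norm_natCast] at *
      gcongr
    · simp only [norm_mul, Complex.norm_natCast] at *
      gcongr
  have s1 : ‖(n : ℂ) * (1 - w) ^ (n - 1) * -w1‖ ≤ E * (x / v) := by
    rw [norm_mul, norm_mul, norm_neg, Complex.norm_natCast, mul_right_comm,
      mul_comm _ ‖(1 - w) ^ (n - 1)‖]
    gcongr
  have t2 : ‖m * (n * w) ^ (m - 1) * (n * w1) * (n * (1 - w) ^ (n - 1) * -w1)‖ ≤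
      m * Z ^ m * (x / v) * (E * (x / v)) := by
    rw [norm_mul]
    refine mul_le_mul ?_ s1 (norm_nonneg _) (by positivity)
    simp only [norm_mul, Complex.norm_natCast] at *
    gcongr
  have t3 : ‖(n * w) ^ m * (n * ((n - 1 : ℕ) * (1 - w) ^ (n - 1 - 1) * -w1) * -w1 +
      n * (1 - w) ^ (n - 1) * -w2)‖ ≤ Z ^ m * (E * (x / v) * (x / v) + E * (x / v ^ 2)) := by
    rw [Nat.sub_sub, norm_mul]
    refine mul_le_mul a0 ((norm_add_le _ _).trans (add_le_add ?_ ?_)) (norm_nonneg _)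
      (by positivity)
    · simp only [norm_mul, Complex.norm_natCast, norm_neg] at *
      calc (n : ℝ) * ((n - 1 : ℕ) * ‖(1 - w) ^ (n - 2)‖ * ‖w1‖) * ‖w1‖
          ≤ n * (n * ‖(1 - w) ^ (n - 2)‖ * ‖w1‖) * ‖w1‖ := by gcongr
        _ = ‖(1 - w) ^ (n - 2)‖ * (n * ‖w1‖) * (n * ‖w1‖) := by ring
        _ ≤ _ := by gcongr
    · rw [norm_mul, norm_mul, norm_neg, Complex.norm_natCast, mul_right_comm,
        mul_comm _ ‖(1 - w) ^ (n - 1)‖]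
      gcongr
  have hm0 : (0 : ℝ) ≤ m := Nat.cast_nonneg m
  rw [powMul2]
  refine (norm_add_le _ _).trans ((add_le_add ((norm_add_le _ _).trans (add_le_add t1 t2))
    ((norm_add_le _ _).trans (add_le_add t2 t3))).trans ?_)
  have e1 : (m + 1) * (m + 2) * (Real.exp (2 * c * B) *
      (Z ^ (m + 1) * Real.exp (-(c * (n * R))))) * (x / v ^ 2) =
      E * Z ^ m * (x / v ^ 2) * ((m + 1) * (m + 2) * Z) := by
    rw [hE]; ring
  have e2 : (m * (m * Z ^ m * (x / v)) * (x / v) + m * Z ^ m * (x / v ^ 2)) * E +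
      m * Z ^ m * (x / v) * (E * (x / v)) +
      (m * Z ^ m * (x / v) * (E * (x / v)) + Z ^ m * (E * (x / v) * (x / v) + E * (x / v ^ 2))) =
      E * Z ^ m * (x / v ^ 2) * ((m ^ 2 + 2 * m + 1) * x + (m + 1)) := by
    field_simp
    ring
  rw [e1, e2]
  -- Since x ≤ Z and 1 ≤ Z, the bracket is at most ((m+1)² + (m+1)) Z = (m+1)(m+2) Z.
  refine mul_le_mul_of_nonneg_left ?_ (by positivity)
  nlinarith [mul_nonneg hm0 hm0]

end PowerBounds

/-! ### From bounds on the symbol to bounds on the kernel. -/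

section Kernel

theorem lintegral_arc_le {f : ℝ → ℝ≥0∞} (hf : Measurable f) :
    ∫⁻ θ in Ioo 0 (2 * Real.pi), f (arc θ) ≤ 2 * ∫⁻ v in Ioc 0 4, f v := by
  set F := (Ioc (0 : ℝ) 4).indicator f with hF
  have hFm : Measurable F := hf.indicator measurableSet_Ioc
  calc ∫⁻ θ in Ioo 0 (2 * Real.pi), f (arc θ)
      ≤ ∫⁻ θ in Ioo 0 (2 * Real.pi), (F θ + F (2 * Real.pi - θ)) := by
        refine setLIntegral_mono' measurableSet_Ioo fun θ hθ => ?_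
        have h1 : f (arc θ) = F (arc θ) :=
          (indicator_of_mem (show arc θ ∈ Ioc (0 : ℝ) 4 from ⟨arc_pos hθ, arc_le_four θ⟩) f).symm
        rw [h1]
        rcases min_choice θ (2 * Real.pi - θ) with h | h <;> rw [arc, h]
        · exact le_self_add
        · exact le_add_self
    _ ≤ ∫⁻ θ, (F θ + F (2 * Real.pi - θ)) := setLIntegral_le_lintegral _ _
    _ = 2 * ∫⁻ θ, F θ := by
        rw [lintegral_add_left hFm, lintegral_sub_left_eq_self, two_mul]
    _ = _ := by rw [hF, lintegral_indicator measurableSet_Ioc]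

theorem integrableOn_of_lintegral_le {s : Set ℝ} {f : ℝ → ℂ}
    (hf : AEStronglyMeasurable f (volume.restrict s)) {b : ℝ}
    (h : ∫⁻ θ in s, ‖f θ‖ₑ ≤ ENNReal.ofReal b) : IntegrableOn f s :=
  ⟨hf, lt_of_le_of_lt h ENNReal.ofReal_lt_top⟩

theorem norm_integral_le_of_lintegral_le {s : Set ℝ} {f : ℝ → ℂ} {b : ℝ} (hb : 0 ≤ b)
    (h : ∫⁻ θ in s, ‖f θ‖ₑ ≤ ENNReal.ofReal b) : ‖∫ θ in s, f θ‖ ≤ b := by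
  have := (enorm_integral_le_lintegral_enorm (μ := volume.restrict s) f).trans h
  rw [← ofReal_norm] at this
  exact (ENNReal.ofReal_le_ofReal_iff hb).1 this

theorem norm_exp_neg_int (x : ℤ) (θ : ℝ) : ‖Complex.exp (-(x * θ * Complex.I))‖ = 1 := by
  rw [Complex.exp_neg, norm_inv, norm_exp_int_mul_I, inv_one]

theorem hasDerivAt_exp_neg_int (x : ℤ) (θ : ℝ) :
    HasDerivAt (fun θ : ℝ => Complex.exp (-(x * θ * Complex.I)))
      (Complex.exp (-(x * θ * Complex.I)) * -(x * Complex.I)) θ := by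
  have h1 : HasDerivAt (fun θ : ℝ => (x : ℂ) * θ * Complex.I) (x * Complex.I) θ := by
    simpa using ((Complex.ofRealCLM.hasDerivAt (x := θ)).const_mul (x : ℂ)).mul_const Complex.I
  exact h1.neg.cexp

/-- Two integrations by parts on `(0, 2π)`, for a periodic function with a singularity at `0`. -/
theorem sq_mul_norm_fourier_le {G G1 G2 : ℝ → ℂ} {g0 : ℂ} {b b2 : ℝ}
    (h1 : ∀ θ ∈ Ioo 0 (2 * Real.pi), HasDerivAt G (G1 θ) θ)
    (h2 : ∀ θ ∈ Ioo 0 (2 * Real.pi), HasDerivAt G1 (G2 θ) θ)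
    (hG : ∫⁻ θ in Ioo 0 (2 * Real.pi), ‖G θ‖ₑ ≤ ENNReal.ofReal b) (hb2 : 0 ≤ b2)
    (hG2 : ∫⁻ θ in Ioo 0 (2 * Real.pi), ‖G2 θ‖ₑ ≤ ENNReal.ofReal b2)
    (hl : Filter.Tendsto G (nhdsWithin 0 (Ioi 0)) (nhds g0))
    (hl1 : Filter.Tendsto G1 (nhdsWithin 0 (Ioi 0)) (nhds 0))
    (hr : Filter.Tendsto G (nhdsWithin (2 * Real.pi) (Iio (2 * Real.pi))) (nhds g0))
    (hr1 : Filter.Tendsto G1 (nhdsWithin (2 * Real.pi) (Iio (2 * Real.pi))) (nhds 0)) (x : ℤ) :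
    (x : ℝ) ^ 2 * ‖∫ θ in Ioo 0 (2 * Real.pi), G θ * Complex.exp (-(x * θ * Complex.I))‖ ≤ b2 := by
  have hpi : (0 : ℝ) < 2 * Real.pi := by positivity
  set e : ℝ → ℂ := fun θ => Complex.exp (-(x * θ * Complex.I)) with he
  have hec : Continuous e := by fun_prop
  have hen : ∀ θ, ‖e θ‖ₑ = 1 := fun θ => by
    rw [← ofReal_norm, norm_exp_neg_int, ENNReal.ofReal_one]
  have hGm : AEStronglyMeasurable G (volume.restrict (Ioo 0 (2 * Real.pi))) :=
    ContinuousOn.aestronglyMeasurable (fun θ hθ => (h1 θ hθ).continuousAt.continuousWithinAt)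
      measurableSet_Ioo
  -- No regularity of `G2` is assumed; it is measurable on the interval because it is a derivative
  -- there.
  have hG2m : AEStronglyMeasurable G2 (volume.restrict (Ioo 0 (2 * Real.pi))) := by
    refine (measurable_deriv G1).aestronglyMeasurable.congr ?_
    filter_upwards [ae_restrict_mem measurableSet_Ioo] with θ hθ
    exact (h2 θ hθ).deriv
  have hGi : IntegrableOn (fun θ => G θ * e θ) (Ioo 0 (2 * Real.pi)) :=
    integrableOn_of_lintegral_le (hGm.mul hec.aestronglyMeasurable) (by
      simpa only [enorm_mul, hen, mul_one] using hG)
  have hG2l : ∫⁻ θ in Ioo 0 (2 * Real.pi), ‖G2 θ * e θ‖ₑ ≤ ENNReal.ofReal b2 := by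
    simpa only [enorm_mul, hen, mul_one] using hG2
  have hG2i : IntegrableOn (fun θ => G2 θ * e θ) (Ioo 0 (2 * Real.pi)) :=
    integrableOn_of_lintegral_le (hG2m.mul hec.aestronglyMeasurable) hG2l
  have hFi : IntegrableOn (fun θ => G2 θ * e θ + (x : ℂ) ^ 2 * (G θ * e θ))
      (Ioo 0 (2 * Real.pi)) := hG2i.add (hGi.const_mul _)
  have hlim : ∀ (l : Filter ℝ) (y : ℝ), Filter.Tendsto G l (nhds g0) →
      Filter.Tendsto G1 l (nhds 0) → l ≤ nhds y → e y = 1 →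
      Filter.Tendsto (fun θ => (G1 θ + x * Complex.I * G θ) * e θ) l
        (nhds (x * Complex.I * g0)) := by
    intro l y hG hG1 hy hy1
    have := (hG1.add (hG.const_mul (x * Complex.I))).mul (hec.continuousAt.tendsto.mono_left hy)
    rwa [hy1, zero_add, mul_one] at this
  -- Both integrations by parts are done at once: (G' + ixG) e^{-ixθ} has derivative (G'' + x²G)
  -- e^{-ixθ} and the same limit ix g0 at both endpoints.
  have key := intervalIntegral.integral_eq_sub_of_hasDerivAt_of_tendsto hpi
    (f := fun θ => (G1 θ + x * Complex.I * G θ) * e θ)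
    (f' := fun θ => G2 θ * e θ + (x : ℂ) ^ 2 * (G θ * e θ)) (fun θ hθ => by
      convert! ((h2 θ hθ).add ((h1 θ hθ).const_mul (x * Complex.I))).mul
        (hasDerivAt_exp_neg_int x θ) using 1
      simp only [he, Pi.add_apply]
      linear_combination (x : ℂ) ^ 2 * (G θ * Complex.exp (-(x * θ * Complex.I))) * Complex.I_sq)
    ((intervalIntegrable_iff_integrableOn_Ioo_of_le hpi.le).2 hFi)
    (hlim _ 0 hl hl1 nhdsWithin_le_nhds (by simp [he]))
    (hlim _ (2 * Real.pi) hr hr1 nhdsWithin_le_nhds (by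
      have : ((x : ℂ) * ((2 * Real.pi : ℝ) : ℂ) * Complex.I) = x * (2 * Real.pi * Complex.I) := by
        push_cast
        ring
      simp only [he]
      rw [this, Complex.exp_neg, Complex.exp_int_mul_two_pi_mul_I, inv_one]))
  rw [intervalIntegral.integral_of_le hpi.le, integral_Ioc_eq_integral_Ioo,
    integral_add hG2i (hGi.const_mul _), integral_const_mul, sub_self] at key
  have h3 : (x : ℂ) ^ 2 * ∫ θ in Ioo 0 (2 * Real.pi), G θ * e θ =
      -∫ θ in Ioo 0 (2 * Real.pi), G2 θ * e θ := by linear_combination key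
  have h4 := congrArg norm h3
  rw [norm_neg, norm_mul, norm_pow, Complex.norm_intCast, sq_abs] at h4
  rw [h4]
  exact norm_integral_le_of_lintegral_le hb2 hG2l

variable {σ : Measure ℝ} [IsFiniteMeasure σ]

theorem tendsto_symb {l : Filter ℝ} (hσ : ∀ᵐ t ∂σ, t ∈ Ico (0 : ℝ) 1)
    (hl : ∀ᶠ θ in l, θ ∈ Ioo 0 (2 * Real.pi))
    (hS : Filter.Tendsto (fun θ => profile σ (arc θ)) l (nhds 0)) :
    Filter.Tendsto (symb σ) l (nhds 0) := by
  have h : Filter.Tendsto (fun θ => 12000 * profile σ (arc θ)) l (nhds 0) := by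
    simpa using hS.const_mul 12000
  refine squeeze_zero_norm' ?_ h
  filter_upwards [hl] with θ hθ
  have h1 := profile_nonneg hσ (arc_pos hθ)
  refine (norm_symb_le hσ hθ).trans ?_
  nlinarith [arc_le_four θ]

theorem tendsto_powMul1_symb {l : Filter ℝ} (hσ : ∀ᵐ t ∂σ, t ∈ Ico (0 : ℝ) 1)
    (hl : ∀ᶠ θ in l, θ ∈ Ioo 0 (2 * Real.pi))
    (hS : Filter.Tendsto (fun θ => profile σ (arc θ)) l (nhds 0)) (n m : ℕ) :
    Filter.Tendsto (fun θ => powMul1 n m (symb σ θ) (symb1 σ θ)) l (nhds 0) := by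
  have h0 := tendsto_symb hσ hl hS
  have h1 : Filter.Tendsto (symb1 σ) l (nhds 0) := by
    have h : Filter.Tendsto (fun θ => 3000 * profile σ (arc θ)) l (nhds 0) := by
      simpa using hS.const_mul 3000
    refine squeeze_zero_norm' ?_ h
    filter_upwards [hl] with θ hθ
    exact norm_symb1_le hσ hθ
  have hc : Continuous fun p : ℂ × ℂ => powMul1 n m p.1 p.2 := by
    unfold powMul1
    fun_prop
  have h2 := (hc.tendsto (0, 0)).comp (h0.prodMk_nhds h1)
  have h3 : powMul1 n m 0 0 = 0 := by simp [powMul1]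
  rwa [h3] at h2

theorem tendsto_profile_arc_left (hσ : ∀ᵐ t ∂σ, t ∈ Ico (0 : ℝ) 1) :
    Filter.Tendsto (fun θ => profile σ (arc θ)) (nhdsWithin 0 (Ioi 0)) (nhds 0) := by
  refine (tendsto_profile hσ).comp (tendsto_nhdsWithin_iff.2 ⟨?_, ?_⟩)
  · have := continuous_arc.tendsto 0
    rw [arc, sub_zero, min_eq_left (by positivity)] at this
    exact this.mono_left nhdsWithin_le_nhds
  · filter_upwards [Ioo_mem_nhdsGT (show (0 : ℝ) < 2 * Real.pi by positivity)] with θ hθ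
    exact arc_pos hθ

theorem tendsto_profile_arc_right (hσ : ∀ᵐ t ∂σ, t ∈ Ico (0 : ℝ) 1) :
    Filter.Tendsto (fun θ => profile σ (arc θ)) (nhdsWithin (2 * Real.pi) (Iio (2 * Real.pi)))
      (nhds 0) := by
  refine (tendsto_profile hσ).comp (tendsto_nhdsWithin_iff.2 ⟨?_, ?_⟩)
  · have := continuous_arc.tendsto (2 * Real.pi)
    rw [arc, sub_self, min_eq_right (by positivity)] at this
    exact this.mono_left nhdsWithin_le_nhds
  · filter_upwards [Ioo_mem_nhdsLT (show (0 : ℝ) < 2 * Real.pi by positivity)] with θ hθ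
    exact arc_pos hθ

/-- The natural decay is in v Q(v); S ≤ A Q turns it into decay in R = v S(v), the quantity that
also bounds ψ and its derivatives. In c = a/(4A), the 4 comes from `re_symb_ge`. -/
theorem symbolBound_symb (hσ : ∀ᵐ t ∂σ, t ∈ Ico (0 : ℝ) 1) {A a : ℝ} (hA : 0 < A) (ha : 0 < a)
    (hSQ : ∀ u, 0 < u → u ≤ 4 → profile σ u ≤ A * profileDeriv σ u) {θ : ℝ}
    (hθ : θ ∈ Ioo 0 (2 * Real.pi))
    (hdec : ‖1 - symb σ θ‖ ≤ Real.exp (-(a * (symb σ θ).re))) :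
    SymbolBound 3000 (a / (4 * A)) (4 * profile σ 4) (arc θ) (arc θ * profile σ (arc θ))
      (symb σ θ) (symb1 σ θ) (symb2 σ θ) := by
  have hv := arc_pos hθ
  have hS := profile_nonneg hσ hv
  refine ⟨by norm_num, by positivity, hv, by positivity, ?_, norm_symb_le hσ hθ, ?_, ?_, ?_⟩
  · exact mul_le_mul (arc_le_four θ) (profile_mono hσ hv (arc_le_four θ)) hS (by norm_num)
  · refine (norm_symb1_le hσ hθ).trans_eq ?_
    field_simp
  · refine (norm_symb2_le hσ hθ).trans_eq ?_
    field_simp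
  · refine hdec.trans (Real.exp_le_exp.2 (neg_le_neg ?_))
    have h1 := re_symb_ge hσ hθ
    have h2 := hSQ _ hv (arc_le_four θ)
    calc a / (4 * A) * (arc θ * profile σ (arc θ))
        ≤ a / (4 * A) * (arc θ * (A * profileDeriv σ (arc θ))) := by gcongr
      _ = a * (arc θ * profileDeriv σ (arc θ) / 4) := by field_simp
      _ ≤ _ := by gcongr

/-- For v ≥ 1/N, monotonicity of S and the choice of N give X ≥ Nv/4; if N = 1, the bound v ≤ 4
suffices. Two powers of 1 + X thus buy a factor (1/N)² / (1/N + v)². -/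
theorem add_sq_le_scale (hσ : ∀ᵐ t ∂σ, t ∈ Ico (0 : ℝ) 1) {n N : ℕ} (hN : 1 ≤ N)
    (hN4 : N = 1 ∨ 1 / 4 ≤ n * (1 / N * profile σ (1 / N))) {v : ℝ} (hv : 0 < v) (hv4 : v ≤ 4) :
    (1 / N + v) ^ 2 ≤ 32 * (1 / N) ^ 2 * (1 + n * (v * profile σ v)) ^ 2 := by
  have hN' : (0 : ℝ) < N := by exact_mod_cast hN
  have hδ : (0 : ℝ) < 1 / N := by positivity
  have hS := profile_nonneg hσ hv
  set X := n * (v * profile σ v) with hX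
  have hX0 : 0 ≤ X := by positivity
  have h1 : 1 ≤ (1 + X) ^ 2 := one_le_pow₀ (by linarith)
  rcases le_total v (1 / N) with h | h
  · have h2 : (1 / N + v) ^ 2 ≤ (2 * (1 / N)) ^ 2 := by gcongr; linarith
    nlinarith [mul_le_mul_of_nonneg_left h1 (sq_nonneg ((1 : ℝ) / N))]
  rcases hN4 with rfl | hN4
  · have h2 : ((1 : ℝ) / (1 : ℕ) + v) ^ 2 ≤ 5 ^ 2 := by gcongr; norm_num; linarith
    norm_num at h2 ⊢
    nlinarith
  · have h2 := profile_mono hσ hδ h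
    have h3 : v ≤ 4 * (1 / N) * X := by
      calc v = v * (4 * (1 / 4)) := by ring
        _ ≤ v * (4 * (n * (1 / N * profile σ (1 / N)))) := by gcongr
        _ ≤ v * (4 * (n * (1 / N * profile σ v))) := by gcongr
        _ = _ := by rw [hX]; ring
    have h4 : (1 / N + v) ^ 2 ≤ (4 * (1 / N) * (1 + X)) ^ 2 := by gcongr; linarith
    nlinarith [sq_nonneg ((1 / N) * (1 + X))]

/-- The kernels with symbol `(n ψ) ^ m (1 - ψ) ^ n` are `O(min (1 / N, N / x ^ 2))`. -/
theorem exists_kernel_bound (hσ : ∀ᵐ t ∂σ, t ∈ Ico (0 : ℝ) 1) {A a : ℝ} (hA : 0 < A) (ha : 0 < a)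
    (hSQ : ∀ u, 0 < u → u ≤ 4 → profile σ u ≤ A * profileDeriv σ u)
    (hdec : ∀ θ ∈ Ioo 0 (2 * Real.pi), ‖1 - symb σ θ‖ ≤ Real.exp (-(a * (symb σ θ).re))) (m : ℕ) :
    ∃ C : ℝ, 0 < C ∧ ∀ n : ℕ, ∃ N : ℕ, 1 ≤ N ∧ ∀ x : ℤ,
      ‖∫ θ in Ioo 0 (2 * Real.pi),
        powMul n m (symb σ θ) * Complex.exp (-(x * θ * Complex.I))‖ ≤ C / N ∧
      (x : ℝ) ^ 2 * ‖∫ θ in Ioo 0 (2 * Real.pi),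
        powMul n m (symb σ θ) * Complex.exp (-(x * θ * Complex.I))‖ ≤ C * N := by
  have hsb := fun θ hθ => symbolBound_symb hσ hA ha hSQ hθ (hdec θ hθ)
  have hc0 : 0 < a / (4 * A) := by positivity
  generalize a / (4 * A) = c at hsb hc0
  -- The exponent m + 2 covers the m powers in the symbol plus two for `add_sq_le_scale`, and the m
  -- + 1 powers in the second derivative plus one that turns X into X/(1+X).
  obtain ⟨D, hD, hDle⟩ := exists_one_add_pow_mul_exp_le (m + 2) hc0
  set M := Real.exp (2 * c * (4 * profile σ 4)) with hM
  have hM0 : 0 < M := Real.exp_pos _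
  set C1 := M * (3000 ^ m * D) with hC1
  set C2 := ((m + 1) * (m + 2)) * (M * (3000 ^ (m + 1) * D)) * 3000 with hC2
  have hC10 : 0 < C1 := by positivity
  have hC20 : 0 < C2 := by positivity
  refine ⟨64 * C1 + 2 * (C2 * A + C2 * 4), by positivity, fun n => ?_⟩
  obtain ⟨N, hN, hN1, hN4⟩ := exists_scale hσ n
  have hN' : (0 : ℝ) < N := by exact_mod_cast hN
  have hδ : (0 : ℝ) < 1 / N := by positivity
  refine ⟨N, hN, fun x => ?_⟩
  have hpt : ∀ θ ∈ Ioo 0 (2 * Real.pi), ‖powMul n m (symb σ θ)‖ₑ ≤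
      ENNReal.ofReal (32 * C1 * (1 / N)) * ENNReal.ofReal (1 / N / (1 / N + arc θ) ^ 2) := by
    intro θ hθ
    have hv := arc_pos hθ
    have hS := profile_nonneg hσ hv
    rw [← ofReal_norm, ← ENNReal.ofReal_mul (by positivity)]
    refine ENNReal.ofReal_le_ofReal (((hsb θ hθ).norm_powMul_le n m).trans ?_)
    rw [← hM]
    have h1 := add_sq_le_scale hσ hN hN4 hv (arc_le_four θ)
    set X := n * (arc θ * profile σ (arc θ)) with hX
    have hX0 : 0 ≤ X := by positivity
    rw [mul_div_assoc' (32 * C1 * (1 / (N : ℝ))), le_div_iff₀ (by positivity)]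
    calc M * ((3000 * (1 + X)) ^ m * Real.exp (-(c * X))) * (1 / N + arc θ) ^ 2
        ≤ M * ((3000 * (1 + X)) ^ m * Real.exp (-(c * X))) *
          (32 * (1 / N) ^ 2 * (1 + X) ^ 2) := by gcongr
      _ = 32 * (M * (3000 ^ m * ((1 + X) ^ (m + 2) * Real.exp (-(c * X))))) * (1 / N) * (1 / N) := by
          rw [mul_pow]; ring
      _ ≤ 32 * (M * (3000 ^ m * D)) * (1 / N) * (1 / N) := by
          gcongr
          exact hDle X hX0
      _ = _ := by rw [hC1]
  have hpt2 : ∀ θ ∈ Ioo 0 (2 * Real.pi),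
      ‖powMul2 n m (symb σ θ) (symb1 σ θ) (symb2 σ θ)‖ₑ ≤
      (Iic (1 / N : ℝ)).indicator
        (fun v => ENNReal.ofReal (C2 * A * n) * ENNReal.ofReal (profileDeriv σ v / v)) (arc θ) +
      ENNReal.ofReal (C2 * 4 * N) * ENNReal.ofReal (1 / N / (1 / N + arc θ) ^ 2) := by
    intro θ hθ
    have hv := arc_pos hθ
    have hS := profile_nonneg hσ hv
    have h1 := (hsb θ hθ).norm_powMul2_le n m
    rw [← hM] at h1
    have h2 := hSQ _ hv (arc_le_four θ)
    set X := n * (arc θ * profile σ (arc θ)) with hX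
    have hX0 : 0 ≤ X := by positivity
    have h3 : ‖powMul2 n m (symb σ θ) (symb1 σ θ) (symb2 σ θ)‖ ≤
        C2 * (X / (1 + X)) / arc θ ^ 2 := by
      refine h1.trans ?_
      calc _ = ((m + 1) * (m + 2)) * (M * (3000 ^ (m + 1) *
            ((1 + X) ^ (m + 2) * Real.exp (-(c * X))))) * 3000 * (X / (1 + X)) / arc θ ^ 2 := by
            rw [mul_pow, pow_succ (1 + X) (m + 1)]
            field_simp
        _ ≤ _ := by
            rw [hC2]
            gcongr
            exact hDle X hX0
    rw [← ofReal_norm]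
    -- For v ≤ 1/N, X/(1+X) ≤ X leaves nS(v)/v, not directly seen to be integrable; S ≤ A Q replaces
    -- it by a multiple of nS'(v). For v > 1/N, X/(1+X) ≤ 1 leaves 1/v² ≤ 4/(1/N + v)².
    rcases le_or_gt (arc θ) (1 / N) with h | h
    · rw [indicator_of_mem (show arc θ ∈ Iic (1 / N : ℝ) from h),
        ← ENNReal.ofReal_mul (by positivity)]
      refine le_add_right (ENNReal.ofReal_le_ofReal (h3.trans ?_))
      have h4 : X / (1 + X) ≤ X := div_le_self hX0 (by linarith)
      calc C2 * (X / (1 + X)) / arc θ ^ 2 ≤ C2 * X / arc θ ^ 2 := by gcongr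
        _ = C2 * n * profile σ (arc θ) / arc θ := by rw [hX]; field_simp
        _ ≤ C2 * n * (A * profileDeriv σ (arc θ)) / arc θ := by gcongr
        _ = _ := by ring
    · rw [indicator_of_notMem (show arc θ ∉ Iic (1 / N : ℝ) from not_le.2 h), zero_add,
        ← ENNReal.ofReal_mul (by positivity)]
      refine ENNReal.ofReal_le_ofReal (h3.trans ?_)
      have h4 : X / (1 + X) ≤ 1 := (div_le_one (by positivity)).2 (by linarith)
      calc C2 * (X / (1 + X)) / arc θ ^ 2 ≤ C2 * 1 / arc θ ^ 2 := by gcongr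
        _ = C2 * 4 / (2 * arc θ) ^ 2 := by field_simp; norm_num
        _ ≤ C2 * 4 / (1 / N + arc θ) ^ 2 := by gcongr; linarith
        _ = _ := by field_simp
  have hlin : 2 * ∫⁻ v in Ioc (0 : ℝ) 4, ENNReal.ofReal (1 / N / (1 / N + v) ^ 2) ≤ 2 := by
    rw [lintegral_div_add_sq hδ (by norm_num)]
    refine (mul_le_mul_right (ENNReal.ofReal_le_one.2 ?_) 2).trans_eq (mul_one 2)
    exact (div_le_one (by positivity)).2 (by linarith)
  have hm1 : Measurable fun v : ℝ => ENNReal.ofReal (1 / N / (1 / N + v) ^ 2) := by fun_prop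
  have hI : ∫⁻ θ in Ioo 0 (2 * Real.pi), ‖powMul n m (symb σ θ)‖ₑ ≤
      ENNReal.ofReal (64 * C1 / N) := by
    calc _ ≤ ∫⁻ θ in Ioo 0 (2 * Real.pi), ENNReal.ofReal (32 * C1 * (1 / N)) *
          ENNReal.ofReal (1 / N / (1 / N + arc θ) ^ 2) :=
          setLIntegral_mono' measurableSet_Ioo hpt
      _ ≤ ENNReal.ofReal (32 * C1 * (1 / N)) * 2 := by
          rw [lintegral_const_mul' _ _ ENNReal.ofReal_ne_top]
          gcongr
          exact (lintegral_arc_le hm1).trans hlin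
      _ = _ := by
          rw [← ENNReal.ofReal_ofNat 2, ← ENNReal.ofReal_mul (by positivity)]
          congr 1
          ring
  have hm2 : Measurable ((Iic (1 / N : ℝ)).indicator
      (fun v => ENNReal.ofReal (C2 * A * n) * ENNReal.ofReal (profileDeriv σ v / v))) :=
    ((measurable_profileDeriv.div measurable_id).ennreal_ofReal.const_mul _).indicator
      measurableSet_Iic
  have hI2 : ∫⁻ θ in Ioo 0 (2 * Real.pi), ‖powMul2 n m (symb σ θ) (symb1 σ θ) (symb2 σ θ)‖ₑ ≤
      ENNReal.ofReal (2 * (C2 * A + C2 * 4) * N) := by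
    calc _ ≤ ∫⁻ θ in Ioo 0 (2 * Real.pi), ((Iic (1 / N : ℝ)).indicator
        (fun v => ENNReal.ofReal (C2 * A * n) * ENNReal.ofReal (profileDeriv σ v / v)) (arc θ) +
        ENNReal.ofReal (C2 * 4 * N) * ENNReal.ofReal (1 / N / (1 / N + arc θ) ^ 2)) :=
          setLIntegral_mono' measurableSet_Ioo hpt2
      _ ≤ 2 * ENNReal.ofReal (C2 * A * N) + ENNReal.ofReal (C2 * 4 * N) * 2 := by
          rw [lintegral_add_left (show Measurable fun θ => (Iic (1 / N : ℝ)).indicator _ (arc θ) from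
            hm2.comp continuous_arc.measurable)]
          refine add_le_add ((lintegral_arc_le hm2).trans ?_) ?_
          · gcongr
            rw [setLIntegral_indicator measurableSet_Iic]
            calc _ ≤ ∫⁻ v in Ioc (0 : ℝ) (1 / N),
                  ENNReal.ofReal (C2 * A * n) * ENNReal.ofReal (profileDeriv σ v / v) :=
                  lintegral_mono_set fun v hv => ⟨hv.2.1, hv.1⟩
              _ ≤ ENNReal.ofReal (C2 * A * n) * ENNReal.ofReal (profile σ (1 / N)) := by
                  rw [lintegral_const_mul' _ _ ENNReal.ofReal_ne_top]
                  gcongr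
                  exact lintegral_profileDeriv_div_le hσ hδ
              _ ≤ _ := by
                  rw [← ENNReal.ofReal_mul (by positivity)]
                  refine ENNReal.ofReal_le_ofReal ?_
                  -- The choice of N gives nS(1/N) ≤ N.
                  calc C2 * A * n * profile σ (1 / N)
                      = C2 * A * N * (n * (1 / N * profile σ (1 / N))) := by field_simp
                    _ ≤ C2 * A * N * 1 := by gcongr
                    _ = _ := mul_one _
          · rw [lintegral_const_mul' _ _ ENNReal.ofReal_ne_top]
            gcongr
            exact (lintegral_arc_le hm1).trans hlin
      _ = _ := by
          rw [← ENNReal.ofReal_ofNat 2, ← ENNReal.ofReal_mul (by positivity),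
            ← ENNReal.ofReal_mul (by positivity), ← ENNReal.ofReal_add (by positivity)
            (by positivity)]
          congr 1
          ring
  have hcont : Continuous (powMul n m) := by unfold powMul; fun_prop
  have hl : ∀ᶠ θ in nhdsWithin 0 (Ioi 0), θ ∈ Ioo 0 (2 * Real.pi) :=
    Ioo_mem_nhdsGT (by positivity)
  have hr : ∀ᶠ θ in nhdsWithin (2 * Real.pi) (Iio (2 * Real.pi)), θ ∈ Ioo 0 (2 * Real.pi) :=
    Ioo_mem_nhdsLT (by positivity)
  have hSl := tendsto_profile_arc_left hσ
  have hSr := tendsto_profile_arc_right hσ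
  constructor
  · have h1 : ∫⁻ θ in Ioo 0 (2 * Real.pi), ‖powMul n m (symb σ θ) *
        Complex.exp (-(x * θ * Complex.I))‖ₑ ≤ ENNReal.ofReal (64 * C1 / N) := by
      refine le_trans (le_of_eq ?_) hI
      congr 1 with θ
      rw [enorm_mul, ← ofReal_norm (Complex.exp _), norm_exp_neg_int, ENNReal.ofReal_one, mul_one]
    refine (norm_integral_le_of_lintegral_le (by positivity) h1).trans ?_
    gcongr
    have : 0 < 2 * (C2 * A + C2 * 4) := by positivity
    linarith
  · refine (sq_mul_norm_fourier_le (G := fun θ => powMul n m (symb σ θ))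
      (fun θ hθ => hasDerivAt_powMul n m (hasDerivAt_symb hσ hθ))
      (fun θ hθ => hasDerivAt_powMul1 n m (hasDerivAt_symb hσ hθ) (hasDerivAt_symb1 hσ hθ))
      hI (by positivity) hI2 ((hcont.tendsto 0).comp (tendsto_symb hσ hl hSl))
      (tendsto_powMul1_symb hσ hl hSl n m) ((hcont.tendsto 0).comp (tendsto_symb hσ hr hSr))
      (tendsto_powMul1_symb hσ hr hSr n m) x).trans ?_
    gcongr
    have : 0 < 64 * C1 := by positivity
    linarith

end Kernel

/-! ### The Ritt property and the weak type bound. -/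

section Main

variable {μ : Measure ℤ} {ν : Measure ℝ}

/-- The kernels `n ^ m μ^{*n} * (δ₀ - μ)^{*m}` are `O(min (1 / N, N / x ^ 2))`. -/
theorem IsCCM.exists_kernel_bound [IsProbabilityMeasure μ] (h : IsCCM μ ν) {L : ℝ} (hL0 : 0 < L)
    (hL : ∀ n : ℕ, (n : ℝ) * ∑' k : {k : ℕ // n ≤ k}, (k : ℝ) * mass μ (k : ℕ) ≤
      L * ∑ k ∈ Finset.Icc 1 n, (k : ℝ) ^ 2 * mass μ (k : ℕ)) (m : ℕ) :
    ∃ C : ℝ, 0 < C ∧ ∀ n : ℕ, ∃ N : ℕ, 1 ≤ N ∧ ∀ b : ℤ → ℝ, Summable b →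
      (∀ θ, ft b θ = ft (mass μ) θ ^ n * (1 - ft (mass μ) θ) ^ m) →
      (∀ x, (n : ℝ) ^ m * |b x| ≤ C / N) ∧
        ∀ x : ℤ, (x : ℝ) ^ 2 * ((n : ℝ) ^ m * |b x|) ≤ C * N := by
  have hfin := h.isFiniteMeasure_tilt
  obtain ⟨C, hC, hCn⟩ := RittZ.exists_kernel_bound h.ae_tilt_mem
    (A := 64 * (16 * L + 3)) (by positivity) h.mass_zero_pos
    (fun u hu hu4 => h.profile_le_profileDeriv hL0 hL hu hu4)
    (fun θ hθ => h.norm_one_sub_symb_le hθ) m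
  refine ⟨C, hC, fun n => ?_⟩
  obtain ⟨N, hN, hx⟩ := hCn n
  refine ⟨N, hN, fun b hb hft => ?_⟩
  have hpi : (0 : ℝ) ≤ 2 * Real.pi := by positivity
  have key : ∀ x : ℤ, (n : ℝ) ^ m * |b x| ≤ ‖∫ θ in Ioo 0 (2 * Real.pi),
      powMul n m (symb (tilt ν) θ) * Complex.exp (-(x * θ * Complex.I))‖ := by
    intro x
    have h1 : ∫ θ in Ioo 0 (2 * Real.pi),
        powMul n m (symb (tilt ν) θ) * Complex.exp (-(x * θ * Complex.I)) =
        (n : ℂ) ^ m * (2 * Real.pi * b x) := by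
      rw [← integral_ft_mul_exp hb, intervalIntegral.integral_of_le hpi,
        integral_Ioc_eq_integral_Ioo, ← integral_const_mul]
      refine setIntegral_congr_fun measurableSet_Ioo fun θ hθ => ?_
      show powMul n m (symb (tilt ν) θ) * Complex.exp (-(x * θ * Complex.I)) =
        (n : ℂ) ^ m * (ft b θ * Complex.exp (-(x * θ * Complex.I)))
      rw [hft, h.ft_mass hθ, powMul, mul_pow]
      ring
    rw [h1, norm_mul, norm_pow, Complex.norm_natCast, norm_mul, Complex.norm_real,
      Real.norm_eq_abs]
    have h2 : 1 ≤ ‖(2 * Real.pi : ℂ)‖ := by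
      rw [norm_mul, Complex.norm_real, Real.norm_of_nonneg Real.pi_pos.le, Complex.norm_ofNat]
      linarith [Real.pi_gt_three]
    gcongr
    exact le_mul_of_one_le_left (abs_nonneg _) h2
  exact ⟨fun x => (key x).trans (hx x).1, fun x =>
    (mul_le_mul_of_nonneg_left (key x) (sq_nonneg _)).trans (hx x).2⟩

theorem ofReal_pow_mul_abs (n : ℕ) (m : ℕ) (y : ℝ) :
    ENNReal.ofReal ((n : ℝ) ^ m * |y|) = (n : ℝ≥0∞) ^ m * ENNReal.ofReal |y| := by
  rw [ENNReal.ofReal_mul (by positivity), ENNReal.ofReal_pow (by positivity),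
    ENNReal.ofReal_natCast]

/-- The case m = 1 of the kernel bound, tested on the constant sequence 1, all of whose averages
equal 1. The reflection j ↦ -j undoes the argument 0 - j of the kernel. -/
theorem IsCCM.isRitt [IsProbabilityMeasure μ] (h : IsCCM μ ν) {L : ℝ} (hL0 : 0 < L)
    (hL : ∀ n : ℕ, (n : ℝ) * ∑' k : {k : ℕ // n ≤ k}, (k : ℝ) * mass μ (k : ℕ) ≤
      L * ∑ k ∈ Finset.Icc 1 n, (k : ℝ) ^ 2 * mass μ (k : ℕ)) : IsRitt μ := by
  obtain ⟨C, hC, hCn⟩ := h.exists_kernel_bound hL0 hL 1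
  refine lt_of_le_of_lt (iSup₂_le fun n _ => ?_)
    (ENNReal.ofReal_lt_top (r := 24 * C))
  obtain ⟨N, hN, hb⟩ := hCn n
  have hs := (hasSum_mass μ).summable
  obtain ⟨h1, h2⟩ := hb (convPow (mass μ) n - convPow (mass μ) (n + 1))
    ((summable_convPow hs n).sub (summable_convPow hs (n + 1))) (fun θ => by
      rw [ft_sub (summable_convPow hs n) (summable_convPow hs (n + 1)), ft_convPow hs,
        ft_convPow hs]
      ring)
  have h3 := tsum_kernel_mul_le hN hC.le h1 h2 (fun _ => 1) 1 0 (fun r => by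
    rw [Finset.sum_const, Int.card_Icc, nsmul_eq_mul, mul_one, mul_one]
    have : ((0 + r + 1 - (0 - r) : ℤ).toNat) = 2 * r + 1 := by lia
    rw [this]
    push_cast
    exact le_rfl)
  refine le_trans (le_of_eq ?_) (h3.trans_eq (mul_one _))
  rw [l1Norm, ← ENNReal.tsum_mul_left, ← (Equiv.neg ℤ).tsum_eq]
  congr 1 with k
  rw [ofReal_pow_mul_abs, pow_one, mul_one, ← Real.norm_eq_abs, ofReal_norm]
  simp

theorem IsCCM.exists_maximalFn_le [IsProbabilityMeasure μ] (h : IsCCM μ ν) {L : ℝ} (hL0 : 0 < L)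
    (hL : ∀ n : ℕ, (n : ℝ) * ∑' k : {k : ℕ // n ≤ k}, (k : ℝ) * mass μ (k : ℕ) ≤
      L * ∑ k ∈ Finset.Icc 1 n, (k : ℝ) ^ 2 * mass μ (k : ℕ)) (m : ℕ) :
    ∃ K : ℝ≥0, 0 < K ∧ ∀ (f : ℤ → ℂ) (k : ℤ) (B : ℝ≥0∞),
      (∀ r : ℕ, ∑ j ∈ Finset.Icc (k - r) (k + r), ‖f j‖ₑ ≤ (2 * r + 1 : ℝ≥0∞) * B) →
      maximalFn μ m f k ≤ K * B := by
  obtain ⟨C, hC, hCn⟩ := h.exists_kernel_bound hL0 hL m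
  refine ⟨(24 * C).toNNReal, Real.toNNReal_pos.2 (by positivity), fun f k B hB => ?_⟩
  refine iSup₂_le fun n _ => ?_
  obtain ⟨N, hN, hb⟩ := hCn n
  have hs := (hasSum_mass μ).summable
  have hds : Summable (delta - mass μ) := summable_delta.sub hs
  obtain ⟨h1, h2⟩ := hb (conv (convPow (mass μ) n) (convPow (delta - mass μ) m))
    (summable_conv (summable_convPow hs n) (summable_convPow hds m)) (fun θ => by
      rw [ft_conv (summable_convPow hs n) (summable_convPow hds m), ft_convPow hs,
        ft_convPow hds, ft_sub summable_delta hs, ft_delta])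
  refine le_trans ?_ (tsum_kernel_mul_le hN hC.le h1 h2 (fun j => ‖f j‖ₑ) B k hB)
  simp_rw [ofReal_pow_mul_abs, mul_assoc]
  rw [ENNReal.tsum_mul_left]
  gcongr
  exact enorm_conv_le _ _ _

end Main

end RittZ

theorem theorem4p3 (μ : Measure ℤ) [IsProbabilityMeasure μ] (ν : Measure ℝ)
    (hμ : RittZ.IsCCM μ ν)
    (hL : ∃ L : ℝ, 0 < L ∧ ∀ n : ℕ,
      (n : ℝ) * ∑' k : {k : ℕ // n ≤ k}, (k : ℝ) * RittZ.mass μ (k : ℕ) ≤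
        L * ∑ k ∈ Finset.Icc 1 n, (k : ℝ) ^ 2 * RittZ.mass μ (k : ℕ)) :
    RittZ.IsRitt μ ∧
    ∀ m : ℕ, ∃ C : ℝ≥0, 0 < C ∧ ∀ f : ℤ → ℂ, Memℓp f 1 →
      (⨆ t : ℝ≥0, ⨆ _ : 0 < t, (t : ℝ≥0∞) *
        (({k : ℤ | (t : ℝ≥0∞) ≤ RittZ.maximalFn μ m f k}.encard : ℕ∞) : ℝ≥0∞)) ≤
        (C : ℝ≥0∞) * RittZ.l1Norm f := by
  obtain ⟨L, hL0, hL⟩ := hL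
  refine ⟨hμ.isRitt hL0 hL, fun m => ?_⟩
  obtain ⟨K, hK, hmax⟩ := hμ.exists_maximalFn_le hL0 hL m
  refine ⟨6 * K, by positivity, fun f _ => iSup₂_le fun t ht => ?_⟩
  -- If every average around k were below t/(2K), the maximal function at k would be at most t/2 <
  -- t. The final constant is 6K = 3 · 2K.
  have h1 : ∀ k ∈ {k : ℤ | (t : ℝ≥0∞) ≤ RittZ.maximalFn μ m f k}, ∃ r : ℕ,
      (2 * r + 1 : ℝ≥0∞) * ((t / (2 * K) : ℝ≥0) : ℝ≥0∞) ≤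
        ∑ j ∈ Finset.Icc (k - r) (k + r), ‖f j‖ₑ := by
    intro k hk
    by_contra! hlt
    have h2 : (t : ℝ≥0∞) ≤ ((K * (t / (2 * K)) : ℝ≥0) : ℝ≥0∞) := by
      rw [ENNReal.coe_mul]
      exact le_trans hk (hmax f k _ fun r => (hlt r).le)
    have h3 : K * (t / (2 * K)) = t / 2 := by field_simp
    rw [h3, ENNReal.coe_le_coe] at h2
    exact absurd h2 (not_le.2 (NNReal.half_lt_self ht.ne'))
  have h4 := RittZ.mul_encard_le_of_average_ge _ _ _ h1
  have h5 : (t : ℝ≥0∞) = ((2 * K : ℝ≥0) : ℝ≥0∞) * ((t / (2 * K) : ℝ≥0) : ℝ≥0∞) := by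
    rw [← ENNReal.coe_mul]
    congr 1
    field_simp
  have h6 (e : ℝ≥0∞) : (t : ℝ≥0∞) * e =
      ((2 * K : ℝ≥0) : ℝ≥0∞) * (((t / (2 * K) : ℝ≥0) : ℝ≥0∞) * e) := by
    rw [← mul_assoc, ← h5]
  rw [h6]
  refine (mul_le_mul_right h4 _).trans_eq ?_
  rw [RittZ.l1Norm, ← mul_assoc]
  congr 1
  push_cast
  ring
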